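/- Let $1\le m<n$. Suppose that $n$ rankable objects are in uniformly random order (all $n!$ orders equally likely) and that only the first $M$ of them are presented, one at a time, where $M$ is uniformly distributed on $\{1,\dots,n\}$ and independent of the order. At each time $t\le M$ the relative rank of the $t$-th object among the first $t$ is observed; the object is a candidate if it is relatively best. At most $m$ candidates may be chosen sequentially, each choice being made at the moment the candidate appears and depending only on what has been observed so far. A candidate chosen at time $t$ yields the payoff $T-t$, where $T$ is the arrival time of the next candidate, or $M+1$ if there is none; the aim is to maximize the expected total payoff. Put $\pi_i=P(M\ge i)$, $p_i=P(M=i)$ and, for $i<j$, $$p(i,j)=\frac{i}{j(j-1)}\frac{\pi_j}{\pi_i},\qquad q(i,j)=p(i,j)+\frac{i}{j-1}\frac{p_{j-1}}{\pi_i},$$ $$U_i=\sum_{j=i+1}^{n+1}(j-i)\,q(i,j),\qquad \widetilde V_i=\sum_{j=i+1}^{n}p(i,j)\,U_j,\qquad G_i^{(1)}=\frac{\pi_i}{i}\,(U_i-\widetilde V_i)\quad(1\le i\le n),$$ and recursively $s_k=\min\{i\in\{1,\dots,n\}:G_i^{(k)}\ge 0\}$ for $1\le k\le m$ and $$G_i^{(k)}=G_i^{(1)}+\sum_{j=\max(i+1,\,s_{k-1})}^{n}\frac{1}{j-1}\,G_j^{(k-1)}\qquad(1\le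 i\le n,\ 2\le k\le m).$$ Then the following hold. (1) All these minima exist, so that $s_1,\dots,s_m\in\{1,\dots,n\}$ are well defined. For $1\le k\le m$: if $G_i^{(k)}\ge0$ and $1\le i<n$, then $G_{i+1}^{(k)}\ge0$; and if $1\le i<s_k$, then $G_i^{(k)}\le G_{i+1}^{(k)}$. For $1\le k<m$: $G_i^{(k)}\le G_i^{(k+1)}$ for $1\le i\le n$, and $s_{k+1}\le s_k$. (2) The following threshold strategy maximizes the expected total payoff among all strategies: whenever $k$ choices ($1\le k\le m$) remain to be made, choose immediately the first candidate, if any, to appear at or after time $s_k$. Moreover, for every time $t\ge1$ and every $1\le k\le m$, the same rule, applied from time $t$ on with $k$ choices left, maximizes the conditional expected payoff from the choices made from time $t$ on, given the observations up to and including time $t$. -/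

import Mathlib

open MeasureTheory ProbabilityTheory
open scoped Nat

noncomputable section

namespace MultiDuration

/-! ### The random sequence of objects, the observations and the payoff

An arrival order is `σ : Equiv.Perm (Fin n)`: the object that would be presented at time `t`
(`1 ≤ t ≤ n`) has index `t - 1`, and `σ` of the index is its absolute rank (`0` is the best).
Only the first `M` objects are presented. -/

/-- Arrival orders form a finite type; every set of arrival orders is measurable. -/
instance instMeasurableSpacePerm (n : ℕ) : MeasurableSpace (Equiv.Perm (Fin n)) := ⊤

/-- Relative rank of the object with arrival time `t` among the first `t` objects
(`1` is relatively best). It is `0` when `t` is not in `{1, …, n}`. -/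
def relRank {n : ℕ} (σ : Equiv.Perm (Fin n)) (t : ℕ) : ℕ :=
  (Finset.univ.filter fun a : Fin n => ∃ b : Fin n, b.val + 1 = t ∧ a ≤ b ∧ σ a ≤ σ b).card

variable {Ω : Type*}

/-- What is observed at time `t`: the relative rank of the `t`-th object if it is presented, and
`0` if no object is presented. In particular `obs σ M t ω = 1` says that a candidate (a relatively
best object) appears at time `t`. -/
def obs {n : ℕ} (σ : Ω → Equiv.Perm (Fin n)) (M : Ω → ℕ) (t : ℕ) (ω : Ω) : ℕ :=
  if t ≤ M ω then relRank (σ ω) t else 0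

theorem measurable_obs [MeasurableSpace Ω] {n : ℕ} {σ : Ω → Equiv.Perm (Fin n)} {M : Ω → ℕ}
    (hσ : Measurable σ) (hM : Measurable M) (t : ℕ) : Measurable (obs σ M t) := by
  have h1 : Measurable fun ω => relRank (σ ω) t :=
    (measurable_from_top (f := fun π : Equiv.Perm (Fin n) => relRank π t)).comp hσ
  exact Measurable.ite (hM measurableSet_Ici) h1 measurable_const

/-- The information available to the decision maker: the filtration of the observations. -/
def info [MeasurableSpace Ω] {n : ℕ} {σ : Ω → Equiv.Perm (Fin n)} {M : Ω → ℕ}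
    (hσ : Measurable σ) (hM : Measurable M) : Filtration ℕ ‹MeasurableSpace Ω› :=
  Filtration.natural (obs σ M) fun t => (measurable_obs hσ hM t).stronglyMeasurable

/-- The first time after `t` at which either a new candidate appears or no object is presented:
the arrival time of the next candidate, and `M + 1` if there is none (for `t ≤ M`). -/
def nextTime {n : ℕ} (σ : Ω → Equiv.Perm (Fin n)) (M : Ω → ℕ) (t : ℕ) (ω : Ω) : ℕ :=
  sInf {j | t < j ∧ (obs σ M j ω = 1 ∨ M ω < j)}

/-- The time for which the candidate chosen at time `t` is held as a relatively best object. -/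
def duration {n : ℕ} (σ : Ω → Equiv.Perm (Fin n)) (M : Ω → ℕ) (t : ℕ) (ω : Ω) : ℝ :=
  (nextTime σ M t ω : ℝ) - t

/-- Total payoff of a vector of `k` choice times; `⊤` means that the choice is not used. -/
def payoff {n : ℕ} (σ : Ω → Equiv.Perm (Fin n)) (M : Ω → ℕ) {k : ℕ}
    (τ : Fin k → Ω → WithTop ℕ) (ω : Ω) : ℝ :=
  ∑ r, (τ r ω).recTopCoe 0 fun t => duration σ M t ω

/-- The strategies available from time `t` on (after the observation at time `t`, before the
decision about the object presented at time `t`), with `k` choices left: vectors of stopping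
times of the observed process, not smaller than `t`, strictly increasing as long as they are
finite, at which candidates appear. -/
structure IsStrategy [MeasurableSpace Ω] {n : ℕ} {σ : Ω → Equiv.Perm (Fin n)} {M : Ω → ℕ}
    (hσ : Measurable σ) (hM : Measurable M) (t k : ℕ) (τ : Fin k → Ω → WithTop ℕ) : Prop where
  isStoppingTime : ∀ r, IsStoppingTime (info hσ hM) (τ r)
  le : ∀ r ω, (t : WithTop ℕ) ≤ τ r ω
  increasing : ∀ r r', r < r' → ∀ ω, τ r ω < τ r' ω ∨ τ r' ω = ⊤
  candidate : ∀ r ω (j : ℕ), τ r ω = j → obs σ M j ω = 1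

/-- The threshold strategy from time `t` on with `k` choices left: the `r`-th choice time
(`r = 0, 1, …, k - 1`). When `k - r` choices are left, the first candidate to appear at or after
time `s (k - r)` (and after the previous choice) is chosen. -/
def thresholdTime {n : ℕ} (σ : Ω → Equiv.Perm (Fin n)) (M : Ω → ℕ) (s : ℕ → ℕ) (t k : ℕ) :
    ℕ → Ω → WithTop ℕ
  | 0, ω => hittingAfter (obs σ M) {1} (max t (s k)) ω
  | r + 1, ω => (thresholdTime σ M s t k r ω).recTopCoe ⊤ fun j =>
      hittingAfter (obs σ M) {1} (max (j + 1) (s (k - (r + 1)))) ω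

/-- The threshold strategy as a vector of `k` choice times. -/
def thresholdStrategy {n : ℕ} (σ : Ω → Equiv.Perm (Fin n)) (M : Ω → ℕ) (s : ℕ → ℕ) (t k : ℕ) :
    Fin k → Ω → WithTop ℕ :=
  fun r => thresholdTime σ M s t k r

/-! ### The critical numbers

`p ℓ` is the probability that exactly `ℓ` objects are presented, `1 ≤ ℓ ≤ n`. -/

/-- The uniform distribution on `{1, …, n}`. -/
def uniformPrior (n : ℕ) (ℓ : ℕ) : ℝ := if ℓ ∈ Finset.Icc 1 n then 1 / (n : ℝ) else 0

/-- `π_i`, the probability that at least `i` objects are presented. -/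
def tail (n : ℕ) (p : ℕ → ℝ) (i : ℕ) : ℝ := ∑ j ∈ Finset.Icc i n, p j

/-- `p(i,j)`, the probability that the next candidate after a candidate at time `i` appears at
time `j`. -/
def candProb (n : ℕ) (p : ℕ → ℝ) (i j : ℕ) : ℝ :=
  (i : ℝ) / ((j : ℝ) * ((j : ℝ) - 1)) * (tail n p j / tail n p i)

/-- `q(i,j)`, the probability that a candidate at time `i` stops being held at time `j`, by the
arrival of the next candidate or because no object is presented any more. -/
def endProb (n : ℕ) (p : ℕ → ℝ) (i j : ℕ) : ℝ :=
  candProb n p i j + (i : ℝ) / ((j : ℝ) - 1) * (p (j - 1) / tail n p i)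

/-- `U_i`, the mean period for which a candidate at time `i` remains one. -/
def meanDuration (n : ℕ) (p : ℕ → ℝ) (i : ℕ) : ℝ :=
  ∑ j ∈ Finset.Icc (i + 1) (n + 1), ((j : ℝ) - i) * endProb n p i j

/-- `Ṽ_i`, the mean period for which the next candidate after time `i`, if any, remains one. -/
def meanNextDuration (n : ℕ) (p : ℕ → ℝ) (i : ℕ) : ℝ :=
  ∑ j ∈ Finset.Icc (i + 1) n, candProb n p i j * meanDuration n p j

/-- `G_i^{(1)} = (π_i / i) (U_i - Ṽ_i)`. -/
def gainOne (n : ℕ) (p : ℕ → ℝ) (i : ℕ) : ℝ :=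
  tail n p i / i * (meanDuration n p i - meanNextDuration n p i)

/-- The least `i` in `{1, …, n}` with `0 ≤ g i` (junk if there is none). -/
def firstNonneg (n : ℕ) (g : ℕ → ℝ) : ℕ := sInf {i | i ∈ Finset.Icc 1 n ∧ 0 ≤ g i}

/-- `G_i^{(k)}` for `k ≥ 1`, as `gain n p k i` (the value at `k = 0` is irrelevant). -/
def gain (n : ℕ) (p : ℕ → ℝ) : ℕ → ℕ → ℝ
  | 0, _ => 0
  | 1, i => gainOne n p i
  | k + 2, i => gainOne n p i +
      ∑ j ∈ Finset.Icc (max (i + 1) (firstNonneg n (gain n p (k + 1)))) n,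
        1 / ((j : ℝ) - 1) * gain n p (k + 1) j

/-- The critical number `s_k = min {i : G_i^{(k)} ≥ 0}`. -/
def critical (n : ℕ) (p : ℕ → ℝ) (k : ℕ) : ℕ := firstNonneg n (gain n p k)

end MultiDuration

end

open MultiDuration

/-!
The strategy is found by dynamic programming. Let `π_i = P(M ≥ i)`, `A_i = ∑_{j ≥ i} π_j / j`
(`ratioSum`), and let `S_k(i)` be the sum of the positive parts of `G^{(k)}_j` over `j > i`
(`futureValue`), with `G^{(0)} = 0`.

*The critical numbers.* Summation by parts gives `π_i U_i = i A_i`, from which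
`G^{(k+1)}_i = G^{(k+1)}_{i+1} + (π_i - A_{i+1} + max (G^{(k)}_{i+1}) 0) / i` (`gain_succ_eq_add`).
For the uniform prior the sequence `π_i - A_{i+1}` crosses zero at most once, from below
(`decrement_uniformPrior_nonneg`). By induction on `k` so does `G^{(k)}`, which moreover increases
as long as it is negative: the extra terms from `G^{(k-1)}` vanish below `s_{k-1}`, and from
`s_{k-1}` on `G^{(k)} ≥ G^{(k-1)} ≥ 0` (`gain_crossing`).

*The value.* Given `M ≥ i`, the payoff of choosing a candidate at time `i` has mean `i A_i / π_i`,
and `S_k(i) / π_i` turns out to be the optimal expected payoff from the choices after time `i` with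
`k` choices left. The advantage of choosing a candidate at time `i` over passing it by, with
`k + 1` choices left, is then `(i A_i + S_k(i) - S_{k+1}(i)) / π_i`. Its numerator equals
`i G^{(k+1)}_i + ∑_{j > i} min (G^{(k+1)}_j) 0` (`advantage_eq`); by the single crossing it has the
sign of `G^{(k+1)}_i` and the positive part `i max (G^{(k+1)}_i) 0` (`max_advantage_eq`), which is
just what the recursion for `S_{k+1}` requires.

*The process.* The relative ranks determine the permutation (`lehmerCode_bijective`), so that the
object at time `t + 1` is relatively best in exactly one out of `t + 1` of the orders with a given
past (`card_filter_relRank_eq_one`). Hence, given the observations up to time `t` and `M ≥ t`, the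
future has a fixed one-step law (`tail_mul_measureReal_inter_succ`,
`succ_mul_measureReal_inter_candidate`). Backward induction on `t` shows that, on each event known
at time `t`, no strategy from time `t` on exceeds the dynamic programming value
(`setIntegral_payoff_le`) and that the threshold strategy attains it
(`setIntegral_payoff_thresholdStrategy`). As this holds on all such events, it also gives the
inequality of the conditional expectations.
-/

open MultiDuration

/-! ### The critical numbers -/

/-- `A_i = ∑_{j ≥ i} π_j / j`. Up to the factor `i / π_i` this is the mean duration `U_i`. -/
noncomputable def ratioSum (n : ℕ) (p : ℕ → ℝ) (i : ℕ) : ℝ :=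
  ∑ j ∈ Finset.Icc i n, tail n p j / j

/-- `π_i - A_{i+1}`, which is `i` times the decrement of `G^{(1)}` at `i`. -/
noncomputable def decrement (n : ℕ) (p : ℕ → ℝ) (i : ℕ) : ℝ :=
  tail n p i - ratioSum n p (i + 1)

/-- The sum of the positive parts of `G^{(k)}_j` over `j > i`. Divided by `π_i`, it is the optimal
expected payoff from the choices made after time `i`, with `k` choices left, given `M ≥ i`. -/
noncomputable def futureValue (n : ℕ) (p : ℕ → ℝ) (k i : ℕ) : ℝ :=
  ∑ j ∈ Finset.Icc (i + 1) n, max (gain n p k j) 0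

theorem sum_Icc_eq_add {f : ℕ → ℝ} {i n : ℕ} (h : i ≤ n) :
    ∑ j ∈ Finset.Icc i n, f j = f i + ∑ j ∈ Finset.Icc (i + 1) n, f j := by
  rw [← Finset.insert_Icc_add_one_left_eq_Icc h, Finset.sum_insert (by simp)]

section Identities

variable {n : ℕ} {p : ℕ → ℝ}

theorem tail_eq_add {i : ℕ} (h : i ≤ n) : tail n p i = p i + tail n p (i + 1) :=
  sum_Icc_eq_add h

theorem tail_of_lt {i : ℕ} (h : n < i) : tail n p i = 0 := by
  simp [tail, Finset.Icc_eq_empty_of_lt h]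

theorem ratioSum_eq_add {i : ℕ} (h : i ≤ n) :
    ratioSum n p i = tail n p i / i + ratioSum n p (i + 1) :=
  sum_Icc_eq_add h

theorem futureValue_eq_add {k i : ℕ} (h : i < n) :
    futureValue n p k i = max (gain n p k (i + 1)) 0 + futureValue n p k (i + 1) :=
  sum_Icc_eq_add h

/-- Summation by parts. -/
theorem sum_mul_sub_eq (f : ℕ → ℝ) {i n : ℕ} (h : i ≤ n) :
    ∑ j ∈ Finset.Icc (i + 1) n, ((j : ℝ) - i) * (f (j - 1) - f j) =
      ∑ j ∈ Finset.Icc i n, f j - (n + 1 - i) * f n := by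
  induction n, h using Nat.le_induction with
  | base => simp
  | succ n hn ih =>
    rw [Finset.sum_Icc_succ_top (by omega), Finset.sum_Icc_succ_top (by omega), ih]
    rw [Nat.add_sub_cancel]
    push_cast
    ring

theorem tail_div_mul_meanDuration {i : ℕ} (hi : 1 ≤ i) (hin : i ≤ n) (h0 : tail n p i ≠ 0) :
    tail n p i / i * meanDuration n p i = ratioSum n p i := by
  have hi0 : (i : ℝ) ≠ 0 := by positivity
  have h := sum_mul_sub_eq (fun j => tail n p j / j) (show i ≤ n + 1 by omega)
  rw [Finset.sum_Icc_succ_top (f := fun j => tail n p j / j) (by omega),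
    tail_of_lt (Nat.lt_succ_self n)] at h
  simp only [zero_div, mul_zero, add_zero, sub_zero] at h
  rw [ratioSum, ← h, meanDuration, Finset.mul_sum]
  refine Finset.sum_congr rfl fun j hj => ?_
  obtain ⟨hij, hjn⟩ := Finset.mem_Icc.mp hj
  obtain ⟨j, rfl⟩ : ∃ l, j = l + 1 := ⟨j - 1, by omega⟩
  have hj0 : (j : ℝ) ≠ 0 := by
    have : 1 ≤ j := by omega
    positivity
  have hj1 : (j : ℝ) + 1 ≠ 0 := by positivity
  rw [endProb, candProb]
  simp only [Nat.add_sub_cancel]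
  rw [tail_eq_add (show j ≤ n by omega)]
  push_cast
  rw [add_sub_cancel_right]
  field_simp
  ring

theorem gainOne_eq {i : ℕ} (hi : 1 ≤ i) (hin : i ≤ n)
    (h0 : ∀ j ∈ Finset.Icc 1 n, tail n p j ≠ 0) :
    gainOne n p i = ratioSum n p i - ∑ j ∈ Finset.Icc (i + 1) n, ratioSum n p j / ((j : ℝ) - 1) := by
  have hi0 : (i : ℝ) ≠ 0 := by positivity
  have ht := h0 i (Finset.mem_Icc.mpr ⟨hi, hin⟩)
  rw [gainOne, mul_sub, tail_div_mul_meanDuration hi hin ht, meanNextDuration, Finset.mul_sum]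
  congr 1
  refine Finset.sum_congr rfl fun j hj => ?_
  obtain ⟨hij, hjn⟩ := Finset.mem_Icc.mp hj
  have htj := h0 j (Finset.mem_Icc.mpr ⟨by omega, hjn⟩)
  have hj0 : (j : ℝ) ≠ 0 := by
    have : 1 ≤ j := by omega
    positivity
  have hj1 : (j : ℝ) - 1 ≠ 0 := by
    have : (1 : ℝ) < j := by exact_mod_cast (show 1 < j by omega)
    linarith
  rw [← tail_div_mul_meanDuration (by omega) hjn htj, candProb]
  field_simp

theorem gainOne_last (hn : 1 ≤ n) (h0 : ∀ j ∈ Finset.Icc 1 n, tail n p j ≠ 0) :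
    gainOne n p n = tail n p n / n := by
  rw [gainOne_eq hn le_rfl h0]
  simp [ratioSum]

theorem gainOne_eq_add {i : ℕ} (hi : 1 ≤ i) (hin : i < n)
    (h0 : ∀ j ∈ Finset.Icc 1 n, tail n p j ≠ 0) :
    gainOne n p i = gainOne n p (i + 1) + decrement n p i / i := by
  have hi0 : (i : ℝ) ≠ 0 := by positivity
  rw [gainOne_eq hi hin.le h0, gainOne_eq (by omega) hin h0, sum_Icc_eq_add (show i + 1 ≤ n from hin),
    ratioSum_eq_add hin.le, decrement]
  push_cast
  rw [add_sub_cancel_right]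
  field_simp
  ring

/-- The positive parts of `G^{(k)}` may replace the cut-off of the sum at `s_k`, since `G^{(k)}` is
nonnegative exactly from `s_k` on. -/
theorem gain_succ_eq {k i : ℕ} (hk : 1 ≤ k)
    (hc : ∀ j ∈ Finset.Icc 1 n, (0 ≤ gain n p k j ↔ critical n p k ≤ j)) :
    gain n p (k + 1) i = gainOne n p i +
      ∑ j ∈ Finset.Icc (i + 1) n, max (gain n p k j) 0 / ((j : ℝ) - 1) := by
  obtain ⟨k, rfl⟩ : ∃ l, k = l + 1 := ⟨k - 1, by omega⟩
  rw [gain]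
  congr 1
  have hsub : Finset.Icc (max (i + 1) (firstNonneg n (gain n p (k + 1)))) n ⊆
      Finset.Icc (i + 1) n := Finset.Icc_subset_Icc_left (le_max_left _ _)
  rw [← Finset.sum_subset hsub]
  · refine Finset.sum_congr rfl fun j hj => ?_
    obtain ⟨h1, h2⟩ := Finset.mem_Icc.mp hj
    rw [max_eq_left ((hc j (Finset.mem_Icc.mpr ⟨by omega, h2⟩)).mpr
      (le_trans (le_max_right _ _) h1)), one_div, inv_mul_eq_div]
  · intro j hj hj'
    obtain ⟨h1, h2⟩ := Finset.mem_Icc.mp hj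
    have h3 : ¬ critical n p (k + 1) ≤ j := fun h =>
      hj' (Finset.mem_Icc.mpr ⟨max_le h1 h, h2⟩)
    rw [← hc j (Finset.mem_Icc.mpr ⟨by omega, h2⟩), not_le] at h3
    rw [max_eq_right h3.le, zero_div]

theorem gain_succ_last {k : ℕ} (hn : 1 ≤ n) (h0 : ∀ j ∈ Finset.Icc 1 n, tail n p j ≠ 0) :
    gain n p (k + 1) n = tail n p n / n := by
  rw [← gainOne_last hn h0]
  cases k with
  | zero => rfl
  | succ k =>
    rw [gain, Finset.Icc_eq_empty_of_lt (lt_of_lt_of_le n.lt_succ_self (le_max_left _ _))]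
    simp

/-- The basic recursion of the functions `G^{(k)}`; here `G^{(0)} = 0`. -/
theorem gain_succ_eq_add {k i : ℕ} (hi : 1 ≤ i) (hin : i < n)
    (h0 : ∀ j ∈ Finset.Icc 1 n, tail n p j ≠ 0)
    (hc : 1 ≤ k → ∀ j ∈ Finset.Icc 1 n, (0 ≤ gain n p k j ↔ critical n p k ≤ j)) :
    gain n p (k + 1) i = gain n p (k + 1) (i + 1) +
      (decrement n p i + max (gain n p k (i + 1)) 0) / i := by
  rcases Nat.eq_zero_or_pos k with rfl | hk
  · simp only [gain, max_self, add_zero]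
    exact gainOne_eq_add hi hin h0
  · rw [gain_succ_eq hk (hc hk), gain_succ_eq hk (hc hk), gainOne_eq_add hi hin h0,
      sum_Icc_eq_add (show i + 1 ≤ n from hin)]
    push_cast
    rw [add_sub_cancel_right]
    ring

/-- The advantage of choosing a candidate at time `i` over passing it by, with `k + 1` choices
left, expressed through `G^{(k+1)}`. -/
theorem advantage_eq {k i : ℕ} (hi : 1 ≤ i) (hin : i ≤ n)
    (h0 : ∀ j ∈ Finset.Icc 1 n, tail n p j ≠ 0)
    (hc : 1 ≤ k → ∀ j ∈ Finset.Icc 1 n, (0 ≤ gain n p k j ↔ critical n p k ≤ j)) :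
    i * ratioSum n p i + futureValue n p k i - futureValue n p (k + 1) i =
      i * gain n p (k + 1) i + ∑ j ∈ Finset.Icc (i + 1) n, min (gain n p (k + 1) j) 0 := by
  induction hin using Nat.decreasingInduction with
  | self =>
    have : (n : ℝ) ≠ 0 := by positivity
    simp [futureValue, ratioSum, gain_succ_last hi h0]
  | of_succ i hin ih =>
    have hi0 : (i : ℝ) ≠ 0 := by positivity
    have ih := ih (by omega)
    have h1 := gain_succ_eq_add hi hin h0 hc
    have h2 := max_add_min (gain n p (k + 1) (i + 1)) 0
    rw [sum_Icc_eq_add (show i + 1 ≤ n from hin), futureValue_eq_add hin, futureValue_eq_add hin,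
      ratioSum_eq_add hin.le, h1]
    rw [decrement]
    field_simp
    push_cast at ih
    linarith

theorem max_advantage_eq {k i : ℕ} (hi : 1 ≤ i) (hin : i ≤ n)
    (h0 : ∀ j ∈ Finset.Icc 1 n, tail n p j ≠ 0)
    (hc : ∀ k, 1 ≤ k → ∀ j ∈ Finset.Icc 1 n, (0 ≤ gain n p k j ↔ critical n p k ≤ j)) :
    max (i * ratioSum n p i + futureValue n p k i - futureValue n p (k + 1) i) 0 =
        i * max (gain n p (k + 1) i) 0 ∧
      (0 ≤ i * ratioSum n p i + futureValue n p k i - futureValue n p (k + 1) i ↔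
        critical n p (k + 1) ≤ i) := by
  have hi0 : (0 : ℝ) < i := by positivity
  have hci := hc (k + 1) (by omega) i (Finset.mem_Icc.mpr ⟨hi, hin⟩)
  rw [advantage_eq hi hin h0 (hc k)]
  by_cases hs : critical n p (k + 1) ≤ i
  · have hg := hci.mpr hs
    rw [Finset.sum_eq_zero, add_zero]
    · rw [max_eq_left (by positivity), max_eq_left hg]
      exact ⟨rfl, fun _ => hs, fun _ => by positivity⟩
    · intro j hj
      obtain ⟨h1, h2⟩ := Finset.mem_Icc.mp hj
      exact min_eq_right ((hc (k + 1) (by omega) j (Finset.mem_Icc.mpr ⟨by omega, h2⟩)).mpr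
        (by omega))
  · have hg : gain n p (k + 1) i < 0 := not_le.mp fun h => hs (hci.mp h)
    have hsum : ∑ j ∈ Finset.Icc (i + 1) n, min (gain n p (k + 1) j) 0 ≤ 0 :=
      Finset.sum_nonpos fun j _ => min_le_right _ _
    have hneg : i * gain n p (k + 1) i < 0 := mul_neg_of_pos_of_neg hi0 hg
    rw [max_eq_right (by linarith), max_eq_right hg.le, mul_zero]
    exact ⟨rfl, fun h => absurd h (by linarith), fun h => absurd h hs⟩

/-- A function that satisfies the recursion of `gain_succ_eq_add` crosses zero at most once, from
below, and it increases as long as it is negative. The increments `c` vanish below a time `r` from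
which on `g` is known to be nonnegative. -/
theorem nonneg_succ_and_le_succ {d c g : ℕ → ℝ} {r : ℕ} (hrn : r ≤ n)
    (hd : ∀ i, 1 ≤ i → i < n → 0 ≤ d i → 0 ≤ d (i + 1))
    (hg : ∀ i, 1 ≤ i → i < n → g i = g (i + 1) + (d i + c (i + 1)) / i)
    (hc : ∀ i, 0 ≤ c i) (hcr : ∀ i, i < r → c i = 0)
    (hgr : ∀ i, r ≤ i → i ≤ n → 0 ≤ g i) {i : ℕ} (hi : 1 ≤ i) (hin : i < n) :
    (0 ≤ g i → 0 ≤ g (i + 1)) ∧ (g i < 0 → g i ≤ g (i + 1)) := by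
  have hle : ∀ j, 1 ≤ j → j < n → 0 ≤ d j + c (j + 1) → g (j + 1) ≤ g j := by
    intro j hj hjn h
    rw [hg j hj hjn]
    have : 0 ≤ (d j + c (j + 1)) / (j : ℝ) := by positivity
    linarith
  -- Once the decrement is nonnegative, it stays so up to time `r`, where `g` is nonnegative.
  have hpos : ∀ e j, j + e + 1 = r → 1 ≤ j → 0 ≤ d j + c (j + 1) → 0 ≤ g (j + 1) := by
    intro e
    induction e with
    | zero => exact fun j hj _ _ => hgr _ hj.ge (by omega)
    | succ e ih =>
      intro j hj hj1 h
      rw [hcr (j + 1) (by omega), add_zero] at h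
      have h' := add_nonneg (hd j hj1 (by omega) h) (hc (j + 1 + 1))
      exact (ih (j + 1) (by omega) (by omega) h').trans (hle (j + 1) (by omega) (by omega) h')
  have hlt : d i + c (i + 1) < 0 → g i ≤ g (i + 1) := by
    intro h
    rw [hg i hi hin]
    have : (d i + c (i + 1)) / (i : ℝ) ≤ 0 := div_nonpos_of_nonpos_of_nonneg h.le (by positivity)
    linarith
  rcases le_or_gt r i with hr | hr
  · exact ⟨fun _ => hgr _ (by omega) hin, fun h => absurd (hgr i hr hin.le) (not_le.mpr h)⟩
  rcases lt_or_ge (d i + c (i + 1)) 0 with h | h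
  · exact ⟨fun h0 => h0.trans (hlt h), fun _ => hlt h⟩
  · have h1 := hpos (r - i - 1) i (by omega) hi h
    exact ⟨fun _ => h1, fun h0 => absurd (h1.trans (hle i hi hin h)) (not_le.mpr h0)⟩

theorem isLeast_critical {k : ℕ} (hn : 1 ≤ n) (hlast : 0 ≤ gain n p k n) :
    IsLeast {i | i ∈ Finset.Icc 1 n ∧ 0 ≤ gain n p k i} (critical n p k) :=
  ⟨Nat.sInf_mem (s := {i | i ∈ Finset.Icc 1 n ∧ 0 ≤ gain n p k i})
    ⟨n, Finset.mem_Icc.mpr ⟨hn, le_rfl⟩, hlast⟩, fun _ hi => Nat.sInf_le hi⟩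

theorem nonneg_iff_critical_le {k : ℕ} (hn : 1 ≤ n) (hlast : 0 ≤ gain n p k n)
    (hup : ∀ i, 1 ≤ i → i < n → 0 ≤ gain n p k i → 0 ≤ gain n p k (i + 1)) :
    ∀ j ∈ Finset.Icc 1 n, (0 ≤ gain n p k j ↔ critical n p k ≤ j) := by
  intro j hj
  obtain ⟨⟨hs, hs0⟩, hle⟩ := isLeast_critical hn hlast
  obtain ⟨hs1, hsn⟩ := Finset.mem_Icc.mp hs
  refine ⟨fun h => hle ⟨hj, h⟩, fun h => ?_⟩
  have hjn := (Finset.mem_Icc.mp hj).2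
  clear hj
  induction j, h using Nat.le_induction with
  | base => exact hs0
  | succ j hj ih => exact hup j (by omega) (by omega) (ih (by omega))

/-- The single crossing of the decrement of `G^{(1)}` is inherited by all the functions
`G^{(k)}`. -/
theorem gain_crossing (hn : 1 ≤ n) (h0 : ∀ j ∈ Finset.Icc 1 n, 0 < tail n p j)
    (hd : ∀ i, 1 ≤ i → i < n → 0 ≤ decrement n p i → 0 ≤ decrement n p (i + 1)) (k : ℕ) :
    (∀ i ∈ Finset.Icc 1 n, 0 ≤ gain n p (k + 1) i ↔ critical n p (k + 1) ≤ i) ∧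
      (∀ i, 1 ≤ i → i < n → gain n p (k + 1) i < 0 →
        gain n p (k + 1) i ≤ gain n p (k + 1) (i + 1)) ∧
      ∀ i ∈ Finset.Icc 1 n, gain n p (k + 1) i ≤ gain n p (k + 2) i := by
  have h0' : ∀ j ∈ Finset.Icc 1 n, tail n p j ≠ 0 := fun j hj => (h0 j hj).ne'
  have hlast : ∀ k, 0 ≤ gain n p (k + 1) n := fun k => by
    rw [gain_succ_last hn h0']
    exact div_nonneg (h0 n (Finset.mem_Icc.mpr ⟨hn, le_rfl⟩)).le (Nat.cast_nonneg n)
  have hterm : ∀ {l i j : ℕ}, 1 ≤ i → j ∈ Finset.Icc (i + 1) n →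
      0 ≤ max (gain n p l j) 0 / ((j : ℝ) - 1) := fun {l i j} hi hj => by
    have : (1 : ℝ) ≤ j := by exact_mod_cast (show 1 ≤ j by have := (Finset.mem_Icc.mp hj).1; omega)
    exact div_nonneg (le_max_right _ _) (by linarith)
  induction k with
  | zero =>
    have hstep := fun i (hi : 1 ≤ i) (hin : i < n) =>
      nonneg_succ_and_le_succ (d := decrement n p) (c := fun _ => 0) (g := gain n p 1) le_rfl hd
        (fun i hi hin => by rw [add_zero]; exact gainOne_eq_add hi hin h0') (fun _ => le_rfl)
        (fun _ _ => rfl) (fun i h1 h2 => le_antisymm h1 h2 ▸ hlast 0) hi hin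
    have hc := nonneg_iff_critical_le hn (hlast 0) fun i hi hin => (hstep i hi hin).1
    refine ⟨hc, fun i hi hin => (hstep i hi hin).2, fun i hi => ?_⟩
    rw [gain_succ_eq le_rfl hc]
    exact le_add_of_nonneg_right
      (Finset.sum_nonneg fun j hj => hterm (Finset.mem_Icc.mp hi).1 hj)
  | succ k ih =>
    obtain ⟨hc, -, hmono⟩ := ih
    have hs := isLeast_critical hn (hlast k)
    obtain ⟨hs1, hsn⟩ := Finset.mem_Icc.mp hs.1.1
    have hstep := fun i (hi : 1 ≤ i) (hin : i < n) =>
      nonneg_succ_and_le_succ (d := decrement n p)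
        (c := fun i => if i < critical n p (k + 1) then 0 else max (gain n p (k + 1) i) 0)
        (g := gain n p (k + 2)) hsn hd
        (fun i hi hin => by
          rw [gain_succ_eq_add hi hin h0' fun _ => hc]
          split_ifs with h
          · rw [max_eq_right]
            exact (not_le.mp fun h' =>
              absurd ((hc _ (Finset.mem_Icc.mpr ⟨by omega, hin⟩)).mp h') (not_le.mpr h)).le
          · rfl)
        (fun i => by split_ifs <;> simp)
        (fun i h => if_pos h)
        (fun i h1 h2 => ((hc i (Finset.mem_Icc.mpr ⟨by omega, h2⟩)).mpr h1).trans
          (hmono i (Finset.mem_Icc.mpr ⟨by omega, h2⟩))) hi hin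
    have hc' := nonneg_iff_critical_le hn (hlast (k + 1)) fun i hi hin => (hstep i hi hin).1
    refine ⟨hc', fun i hi hin => (hstep i hi hin).2, fun i hi => ?_⟩
    rw [gain_succ_eq (by omega) hc, gain_succ_eq (by omega) hc']
    refine add_le_add le_rfl (Finset.sum_le_sum fun j hj => ?_)
    obtain ⟨h1, h2⟩ := Finset.mem_Icc.mp hj
    have : (1 : ℝ) ≤ j := by exact_mod_cast (show 1 ≤ j by omega)
    exact div_le_div_of_nonneg_right
      (max_le_max (hmono j (Finset.mem_Icc.mpr ⟨by omega, h2⟩)) le_rfl) (by linarith)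

end Identities

/-! ### The uniform prior -/

theorem tail_uniformPrior {n i : ℕ} (hi : 1 ≤ i) (hin : i ≤ n + 1) :
    tail n (uniformPrior n) i = ((n : ℝ) + 1 - i) / n := by
  rw [tail, Finset.sum_congr rfl fun j hj => show uniformPrior n j = 1 / (n : ℝ) from if_pos (Finset.mem_Icc.mpr
    ⟨hi.trans (Finset.mem_Icc.mp hj).1, (Finset.mem_Icc.mp hj).2⟩), Finset.sum_const, Nat.card_Icc,
    nsmul_eq_mul, Nat.cast_sub hin]
  push_cast
  ring

/-- For the uniform prior the decrement first increases and then decreases to the positive value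
`1 / n`, so that it crosses zero at most once. -/
theorem decrement_uniformPrior_nonneg {n i : ℕ} (hi : 1 ≤ i) (hin : i < n)
    (h : 0 ≤ decrement n (uniformPrior n) i) : 0 ≤ decrement n (uniformPrior n) (i + 1) := by
  have hn : (0 : ℝ) < n := by exact_mod_cast (show 0 < n by omega)
  have hstep : ∀ j, 1 ≤ j → j < n → decrement n (uniformPrior n) j =
      decrement n (uniformPrior n) (j + 1) + ((2 * j + 1 : ℝ) - n) / (n * (j + 1)) := by
    intro j hj hjn
    have hj1 : (j : ℝ) + 1 ≠ 0 := by positivity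
    rw [decrement, decrement, ratioSum_eq_add (show j + 1 ≤ n from hjn),
      tail_uniformPrior hj (by omega), tail_uniformPrior (by omega) (by omega)]
    push_cast
    field_simp
    ring
  have hlate : ∀ j, j ≤ n → 1 ≤ j → n ≤ 2 * j + 1 → 0 ≤ decrement n (uniformPrior n) j := by
    intro j hjn
    induction hjn using Nat.decreasingInduction with
    | self =>
      intro hn1 _
      rw [decrement, tail_uniformPrior hn1 (by omega), ratioSum, Finset.Icc_eq_empty_of_lt (by omega)]
      simp
    | of_succ j hjn ih =>
      intro hj h2
      rw [hstep j hj hjn]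
      have h2' : (n : ℝ) ≤ 2 * j + 1 := by exact_mod_cast h2
      exact add_nonneg (ih (by omega) (by omega))
        (div_nonneg (by linarith) (by positivity))
  rcases le_or_gt n (2 * i + 1) with h2 | h2
  · exact hlate (i + 1) hin (by omega) (by omega)
  · have h2' : (2 * i + 1 : ℝ) < n := by exact_mod_cast h2
    have h3 : ((2 * i + 1 : ℝ) - n) / (n * (i + 1)) ≤ 0 :=
      div_nonpos_of_nonpos_of_nonneg (by linarith) (by positivity)
    have := hstep i hi hin
    linarith

/-! ### Relative ranks of a random permutation -/

section RelRank

variable {n : ℕ}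

theorem relRank_val_add_one (π : Equiv.Perm (Fin n)) (a : Fin n) :
    relRank π (a.val + 1) = (Finset.univ.filter fun c : Fin n => c ≤ a ∧ π c ≤ π a).card := by
  rw [relRank]
  congr 1
  ext c
  simp only [Finset.mem_filter, Finset.mem_univ, true_and]
  constructor
  · rintro ⟨b, hb, h⟩
    obtain rfl : b = a := Fin.ext (by omega)
    exact h
  · exact fun h => ⟨a, rfl, h⟩

theorem relRank_eq_zero {π : Equiv.Perm (Fin n)} {t : ℕ} (h : t = 0 ∨ n < t) :
    relRank π t = 0 := by
  rw [relRank, Finset.card_eq_zero, Finset.filter_eq_empty_iff]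
  rintro c - ⟨b, hb, -⟩
  have := b.isLt
  omega

theorem relRank_pos {π : Equiv.Perm (Fin n)} {t : ℕ} (h1 : 1 ≤ t) (h2 : t ≤ n) :
    0 < relRank π t := by
  obtain ⟨t, rfl⟩ : ∃ s, t = s + 1 := ⟨t - 1, by omega⟩
  rw [relRank_val_add_one π ⟨t, h2⟩, Finset.card_pos]
  exact ⟨⟨t, h2⟩, by simp⟩

theorem relRank_val_add_one_le (π : Equiv.Perm (Fin n)) (a : Fin n) :
    relRank π (a.val + 1) ≤ a.val + 1 := by
  rw [relRank_val_add_one, ← Fin.card_Iic a]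
  exact Finset.card_le_card fun c hc => Finset.mem_Iic.mpr (Finset.mem_filter.mp hc).2.1

/-- The sequence of all relative ranks (shifted so that `0` is relatively best): the Lehmer code of
the permutation. -/
def lehmerCode (π : Equiv.Perm (Fin n)) (a : Fin n) : Fin (a.val + 1) :=
  ⟨relRank π (a.val + 1) - 1, by have := relRank_val_add_one_le π a; omega⟩

theorem lehmerCode_apply_eq_iff {π π' : Equiv.Perm (Fin n)} {a : Fin n} :
    lehmerCode π a = lehmerCode π' a ↔ relRank π (a.val + 1) = relRank π' (a.val + 1) := by
  have h1 := relRank_pos (π := π) (Nat.le_add_left 1 a.val) a.isLt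
  have h2 := relRank_pos (π := π') (Nat.le_add_left 1 a.val) a.isLt
  rw [lehmerCode, lehmerCode, Fin.mk.injEq]
  omega

/-- The relative ranks determine the permutation: its values are recovered from the last one
backwards, each one being the value of the observed rank among those not yet used. -/
theorem lehmerCode_injective : Function.Injective (lehmerCode (n := n)) := by
  intro π π' h
  have key : ∀ (π π' : Equiv.Perm (Fin n)) (a : Fin n), (∀ b, a < b → π b = π' b) →
      relRank π (a.val + 1) = relRank π' (a.val + 1) → ¬ π a < π' a := by
    intro π π' a hb hr hlt
    -- The relative rank counts the small values among those not used after position `a`.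
    have hcount : ∀ π : Equiv.Perm (Fin n), relRank π (a.val + 1) =
        (Finset.univ.filter fun v : Fin n => π.symm v ≤ a ∧ v ≤ π a).card := by
      intro π
      rw [relRank_val_add_one]
      refine Finset.card_bij (fun c _ => π c) (fun c hc => ?_) (fun _ _ _ _ h => π.injective h)
        fun v hv => ⟨π.symm v, ?_, π.apply_symm_apply v⟩
      · simpa using hc
      · simpa using hv
    have hset : ∀ v, π.symm v ≤ a → π'.symm v ≤ a := by
      intro v hv
      by_contra hlt'
      have h1 := hb _ (not_le.mp hlt')
      rw [π'.apply_symm_apply] at h1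
      rw [← h1, π.symm_apply_apply] at hv
      exact hlt' hv
    rw [hcount, hcount] at hr
    refine absurd hr (Finset.card_lt_card ?_).ne
    refine Finset.ssubset_iff_of_subset (fun v hv => ?_) |>.mpr ⟨π' a, by simp, ?_⟩
    · simp only [Finset.mem_filter, Finset.mem_univ, true_and] at hv ⊢
      exact ⟨hset v hv.1, hv.2.trans hlt.le⟩
    · simp only [Finset.mem_filter, Finset.mem_univ, true_and]
      exact fun h => absurd h.2 (not_le.mpr hlt)
  have hr : ∀ a : Fin n, relRank π (a.val + 1) = relRank π' (a.val + 1) := fun a =>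
    lehmerCode_apply_eq_iff.mp (congrFun h a)
  have hall : ∀ e : ℕ, ∀ a : Fin n, n ≤ a.val + e → π a = π' a := by
    intro e
    induction e with
    | zero => exact fun a ha => absurd a.isLt (by omega)
    | succ e ih =>
      intro a ha
      have hb : ∀ b, a < b → π b = π' b := fun b hb => ih b (by have := Fin.lt_def.mp hb; omega)
      exact le_antisymm (not_lt.mp (key π' π a (fun b h => (hb b h).symm) (hr a).symm))
        (not_lt.mp (key π π' a hb (hr a)))
  exact Equiv.ext fun a => hall n a (by omega)

theorem lehmerCode_bijective : Function.Bijective (lehmerCode (n := n)) := by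
  rw [Fintype.bijective_iff_injective_and_card]
  refine ⟨lehmerCode_injective, ?_⟩
  rw [Fintype.card_perm, Fintype.card_fin, Fintype.card_pi]
  simp only [Fintype.card_fin]
  rw [Fin.prod_univ_eq_prod_range (fun i => i + 1) n, Finset.prod_range_add_one_eq_factorial]

/-- Among the arrival orders with a property that depends on the first `t` relative ranks only, the
object at time `t + 1` is relatively best in exactly one out of `t + 1`. -/
theorem card_filter_relRank_eq_one {t : ℕ} (ht : t < n) (P : Equiv.Perm (Fin n) → Prop)
    [DecidablePred P]
    (hP : ∀ π π', (∀ j ≤ t, relRank π j = relRank π' j) → P π → P π') :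
    (t + 1) * (Finset.univ.filter fun π => P π ∧ relRank π (t + 1) = 1).card =
      (Finset.univ.filter P).card := by
  set e := Equiv.ofBijective _ (lehmerCode_bijective (n := n)) with he
  have hee : ∀ π, e π = lehmerCode π := fun _ => rfl
  set a : Fin n := ⟨t, ht⟩ with ha
  have hP' : ∀ π π', (∀ b, b ≠ a → e π b = e π' b) → P π → P π' := by
    intro π π' h
    refine hP π π' fun j hj => ?_
    rcases Nat.eq_zero_or_pos j with rfl | hj0
    · rw [relRank_eq_zero (Or.inl rfl), relRank_eq_zero (Or.inl rfl)]
    · obtain ⟨j, rfl⟩ : ∃ s, j = s + 1 := ⟨j - 1, by omega⟩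
      exact lehmerCode_apply_eq_iff.mp (h ⟨j, by omega⟩ (by simp [ha, Fin.ext_iff]; omega))
  have hone : ∀ π, relRank π (t + 1) = 1 ↔ e π a = 0 := by
    intro π
    have := relRank_pos (π := π) (Nat.le_add_left 1 t) ht
    rw [hee, lehmerCode, Fin.ext_iff]
    simp only [ha, Fin.val_zero]
    omega
  have hcard : ∀ F : Finset (Equiv.Perm (Fin n)),
      (t + 1) * F.card = ((Finset.univ : Finset (Fin (t + 1))) ×ˢ F).card := fun F => by
    rw [Finset.card_product, Finset.card_univ, Fintype.card_fin]
  rw [hcard]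
  refine Finset.card_nbij' (fun x => e.symm (Function.update (e x.2) a x.1))
    (fun π => (e π a, e.symm (Function.update (e π) a 0))) ?_ ?_ ?_ ?_
  · rintro ⟨x, π⟩ h
    simp only [Finset.coe_product, Finset.coe_univ, Finset.coe_filter, Finset.mem_univ, true_and,
      Set.mem_prod, Set.mem_univ, Set.mem_ofPred_eq] at h ⊢
    exact hP' π _ (fun b hb => by simp [hb]) h.1
  · intro π h
    simp only [Finset.coe_product, Finset.coe_univ, Finset.coe_filter, Finset.mem_univ, true_and,
      Set.mem_prod, Set.mem_univ, Set.mem_ofPred_eq] at h ⊢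
    exact ⟨hP' π _ (fun b hb => by simp [hb]) h, (hone _).mpr (by simp)⟩
  · rintro ⟨x, π⟩ h
    simp only [Finset.coe_product, Finset.coe_univ, Finset.coe_filter, Finset.mem_univ, true_and,
      Set.mem_prod, Set.mem_univ, Set.mem_ofPred_eq] at h
    have h0 := (hone π).mp h.2
    simp [← h0]
  · intro π h
    simp

end RelRank

/-! ### The observed process -/

/-- The probabilistic setting: `n` objects in uniformly random order `σ`, of which only the first `M`
are presented, where `M` is independent of `σ`, has the point probabilities `p` on `{1, …, n}` and
takes the value `n` with positive probability (that is, all tails `π_1, …, π_n` are positive). -/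
structure IsRandomSearch {Ω : Type*} [MeasurableSpace Ω] (μ : Measure Ω) {n : ℕ} (p : ℕ → ℝ)
    (σ : Ω → Equiv.Perm (Fin n)) (M : Ω → ℕ) : Prop where
  measurable_order : Measurable σ
  measurable_number : Measurable M
  order_law : ∀ π, μ.real (σ ⁻¹' {π}) = 1 / (n ! : ℝ)
  number_law : ∀ ℓ, μ.real (M ⁻¹' {ℓ}) = p ℓ
  indep : IndepFun σ M μ
  prior_eq_zero : ∀ ℓ, ℓ ∉ Finset.Icc 1 n → p ℓ = 0
  tail_pos : ∀ j ∈ Finset.Icc 1 n, 0 < tail n p j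

section Pointwise

variable {Ω : Type*} {n : ℕ} {σ : Ω → Equiv.Perm (Fin n)} {M : Ω → ℕ}

theorem obs_eq_zero_iff {t : ℕ} (h1 : 1 ≤ t) (h2 : t ≤ n) {ω : Ω} :
    obs σ M t ω = 0 ↔ M ω < t := by
  have := relRank_pos (π := σ ω) h1 h2
  rw [obs]
  split_ifs <;> omega

theorem obs_eq_zero_of_lt {t : ℕ} (h : n < t) (ω : Ω) : obs σ M t ω = 0 := by
  rw [obs, relRank_eq_zero (Or.inr h), ite_self]

theorem le_number_of_obs_eq_one {t : ℕ} {ω : Ω} (h : obs σ M t ω = 1) : t ≤ M ω := by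
  by_contra h'
  rw [obs, if_neg h'] at h
  exact zero_ne_one h

theorem lt_nextTime (t : ℕ) (ω : Ω) : t < nextTime σ M t ω :=
  (Nat.sInf_mem (s := {j | t < j ∧ (obs σ M j ω = 1 ∨ M ω < j)})
    ⟨max t (M ω) + 1, by omega, Or.inr (by omega)⟩).1

theorem nextTime_le (t : ℕ) (ω : Ω) : nextTime σ M t ω ≤ max t (M ω) + 1 :=
  Nat.sInf_le ⟨by omega, Or.inr (by omega)⟩

theorem nextTime_eq_of_mem {t : ℕ} {ω : Ω} (h : obs σ M (t + 1) ω = 1 ∨ M ω < t + 1) :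
    nextTime σ M t ω = t + 1 :=
  le_antisymm (Nat.sInf_le ⟨Nat.lt_succ_self t, h⟩) (lt_nextTime t ω)

theorem nextTime_eq_succ {t : ℕ} {ω : Ω} (h : ¬ (obs σ M (t + 1) ω = 1 ∨ M ω < t + 1)) :
    nextTime σ M t ω = nextTime σ M (t + 1) ω := by
  rw [nextTime, nextTime]
  congr 1
  ext j
  refine ⟨fun hj => ⟨lt_of_le_of_ne hj.1 ?_, hj.2⟩, fun hj => ⟨by have := hj.1; omega, hj.2⟩⟩
  rintro rfl
  exact h hj.2

theorem norm_duration_le {ω : Ω} (h : M ω ≤ n) (t : ℕ) : ‖duration σ M t ω‖ ≤ n + 1 := by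
  have h1 := lt_nextTime (σ := σ) (M := M) t ω
  have h2 := nextTime_le (σ := σ) (M := M) t ω
  have h3 : nextTime σ M t ω ≤ t + n + 1 := by omega
  have h1' : (t : ℝ) < nextTime σ M t ω := by exact_mod_cast h1
  have h3' : (nextTime σ M t ω : ℝ) ≤ t + n + 1 := by exact_mod_cast h3
  rw [duration, Real.norm_eq_abs, abs_of_nonneg (by linarith)]
  linarith

end Pointwise

section Transition

variable {Ω : Type*} [MeasurableSpace Ω] {μ : Measure Ω} [IsProbabilityMeasure μ] {n : ℕ}
  {p : ℕ → ℝ} {σ : Ω → Equiv.Perm (Fin n)} {M : Ω → ℕ}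

theorem measurable_duration (hσ : Measurable σ) (hM : Measurable M) (t : ℕ) :
    Measurable (duration σ M t) := by
  have : DiscreteMeasurableSpace (Equiv.Perm (Fin n)) := ⟨fun _ => trivial⟩
  let f : Equiv.Perm (Fin n) × ℕ → ℝ := duration Prod.fst Prod.snd t
  have hf : Measurable f := Measurable.of_discrete
  have heq : duration σ M t = fun ω => f (σ ω, M ω) := rfl
  rw [heq]
  exact hf.comp (hσ.prodMk hM)

theorem measurable_obs_info (hσ : Measurable σ) (hM : Measurable M) {j t : ℕ} (h : j ≤ t) :
    Measurable[info hσ hM t] (obs σ M j) :=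
  Measurable.of_comap_le (le_iSup₂_of_le (f := fun j (_ : j ≤ t) => MeasurableSpace.comap (obs σ M j) _)
    j h le_rfl)

theorem measurableSet_obs_eq_one (hσ : Measurable σ) (hM : Measurable M) (t : ℕ) :
    MeasurableSet[info hσ hM t] {ω | obs σ M t ω = 1} :=
  measurable_obs_info hσ hM le_rfl (measurableSet_singleton 1)

theorem measurableSet_le_number (hσ : Measurable σ) (hM : Measurable M) {t : ℕ} (h1 : 1 ≤ t)
    (h2 : t ≤ n) : MeasurableSet[info hσ hM t] {ω | t ≤ M ω} := by
  have h : {ω | t ≤ M ω} = obs σ M t ⁻¹' {0}ᶜ := by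
    ext ω
    simp [obs_eq_zero_iff h1 h2]
  rw [h]
  exact measurable_obs_info hσ hM le_rfl (measurableSet_singleton 0).compl

/-- An event known at time `t` is a union of atoms of the observations up to time `t`. -/
theorem mem_of_obs_eq (hσ : Measurable σ) (hM : Measurable M) {t : ℕ} {A : Set Ω}
    (hA : MeasurableSet[info hσ hM t] A) {ω ω' : Ω}
    (h : ∀ j ≤ t, obs σ M j ω = obs σ M j ω') : ω ∈ A ↔ ω' ∈ A := by
  have hle : (⨆ j ≤ t, MeasurableSpace.comap (obs σ M j) inferInstance) ≤
      MeasurableSpace.comap (fun ω (j : Set.Iic t) => obs σ M j ω) ⊤ := by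
    refine iSup₂_le fun j hj => ?_
    rintro _ ⟨s, -, rfl⟩
    exact ⟨{x | x ⟨j, hj⟩ ∈ s}, trivial, rfl⟩
  -- `A` is the preimage of a set of observed paths, hence determined by the path.
  obtain ⟨S, -, rfl⟩ := hle A hA
  have heq : (fun j : Set.Iic t => obs σ M j ω) = fun j : Set.Iic t => obs σ M j ω' := funext fun j => h j j.2
  rw [Set.mem_preimage, Set.mem_preimage, heq]

/-- On `{M ≥ t}`, an event known at time `t` is an event about the first `t` relative ranks of the
arrival order. -/
theorem exists_order_event (hσ : Measurable σ) (hM : Measurable M) {t : ℕ} {A : Set Ω}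
    (hA : MeasurableSet[info hσ hM t] A) :
    ∃ P : Equiv.Perm (Fin n) → Prop,
      (∀ π π', (∀ j ≤ t, relRank π j = relRank π' j) → P π → P π') ∧
      ∀ ω, t ≤ M ω → (ω ∈ A ↔ P (σ ω)) := by
  refine ⟨fun π => ∃ ω ∈ A, t ≤ M ω ∧ ∀ j ≤ t, relRank (σ ω) j = relRank π j, ?_, ?_⟩
  · rintro π π' hππ' ⟨ω, hω, ht, hr⟩
    exact ⟨ω, hω, ht, fun j hj => (hr j hj).trans (hππ' j hj)⟩
  · refine fun ω ht => ⟨fun hω => ⟨ω, hω, ht, fun _ _ => rfl⟩, ?_⟩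
    rintro ⟨ω', hω', ht', hr⟩
    refine (mem_of_obs_eq hσ hM hA fun j hj => ?_).mp hω'
    rw [obs, obs, if_pos (hj.trans ht'), if_pos (hj.trans ht), hr j hj]

namespace IsRandomSearch


theorem number_mem (h : IsRandomSearch μ p σ M) : ∀ᵐ ω ∂μ, M ω ∈ Finset.Icc 1 n := by
  have : ∀ ℓ, ∀ᵐ ω ∂μ, ℓ ∉ Finset.Icc 1 n → M ω ≠ ℓ := by
    intro ℓ
    by_cases hℓ : ℓ ∈ Finset.Icc 1 n
    · exact Filter.Eventually.of_forall fun _ h' => absurd hℓ h'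
    · have h0 := h.number_law ℓ
      rw [h.prior_eq_zero ℓ hℓ, measureReal_eq_zero_iff] at h0
      filter_upwards [measure_eq_zero_iff_ae_notMem.mp h0] with ω hω _ using hω
  filter_upwards [ae_all_iff.mpr this] with ω hω
  by_contra h'
  exact hω _ h' rfl

theorem measureReal_le_number (h : IsRandomSearch μ p σ M) (i : ℕ) : μ.real {ω | i ≤ M ω} = tail n p i := by
  rw [tail, ← Finset.sum_congr rfl fun ℓ _ => h.number_law ℓ,
    sum_measureReal_preimage_singleton _ fun ℓ _ => h.measurable_number (measurableSet_singleton ℓ)]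
  refine measureReal_congr ?_
  filter_upwards [h.number_mem] with ω hω
  refine propext ⟨fun hi => ?_, fun hi => ?_⟩
  · exact Finset.mem_coe.mpr (Finset.mem_Icc.mpr ⟨hi, (Finset.mem_Icc.mp hω).2⟩)
  · exact (Finset.mem_Icc.mp (Finset.mem_coe.mp hi)).1

theorem measureReal_order_and_number (h : IsRandomSearch μ p σ M) (B : Finset (Equiv.Perm (Fin n))) (i : ℕ) :
    μ.real {ω | σ ω ∈ B ∧ i ≤ M ω} = B.card / (n ! : ℝ) * tail n p i := by
  have h1 : μ.real (σ ⁻¹' B) = B.card / (n ! : ℝ) := by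
    rw [← sum_measureReal_preimage_singleton _ fun π _ => h.measurable_order trivial,
      Finset.sum_congr rfl fun π _ => h.order_law π, Finset.sum_const, nsmul_eq_mul, mul_one_div]
  have h2 := h.indep.measure_inter_preimage_eq_mul (B : Set (Equiv.Perm (Fin n))) (Set.Ici i)
    trivial measurableSet_Ici
  rw [← h1, ← h.measureReal_le_number i]
  exact (congrArg ENNReal.toReal h2).trans ENNReal.toReal_mul

/-- Given the observations up to time `t` and `M ≥ t`, an object is presented at time `t + 1` with
probability `π_{t+1} / π_t`. -/
theorem tail_mul_measureReal_inter_succ (h : IsRandomSearch μ p σ M) {t : ℕ} {A : Set Ω}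
    (hA : MeasurableSet[info h.measurable_order h.measurable_number t] A) :
    tail n p t * μ.real (A ∩ {ω | t + 1 ≤ M ω}) = tail n p (t + 1) * μ.real (A ∩ {ω | t ≤ M ω}) := by
  classical
  obtain ⟨P, -, hP⟩ := exists_order_event h.measurable_order h.measurable_number hA
  have key : ∀ i, t ≤ i → A ∩ {ω | i ≤ M ω} = {ω | σ ω ∈ Finset.univ.filter P ∧ i ≤ M ω} := by
    intro i hi
    ext ω
    simp only [Set.mem_inter_iff, Set.mem_ofPred_eq, Finset.mem_filter, Finset.mem_univ, true_and]
    exact and_congr_left fun hi' => hP ω (hi.trans hi')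
  rw [key t le_rfl, key (t + 1) (Nat.le_succ t), h.measureReal_order_and_number,
    h.measureReal_order_and_number]
  ring

/-- Given the observations up to time `t` and `M ≥ t + 1`, a candidate appears at time `t + 1` with
probability `1 / (t + 1)`. -/
theorem succ_mul_measureReal_inter_candidate (h : IsRandomSearch μ p σ M) {t : ℕ} (ht : t < n) {A : Set Ω}
    (hA : MeasurableSet[info h.measurable_order h.measurable_number t] A) :
    ((t : ℝ) + 1) * μ.real (A ∩ {ω | obs σ M (t + 1) ω = 1}) = μ.real (A ∩ {ω | t + 1 ≤ M ω}) := by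
  classical
  obtain ⟨P, hP', hP⟩ := exists_order_event h.measurable_order h.measurable_number hA
  have h1 : A ∩ {ω | t + 1 ≤ M ω} = {ω | σ ω ∈ Finset.univ.filter P ∧ t + 1 ≤ M ω} := by
    ext ω
    simp only [Set.mem_inter_iff, Set.mem_ofPred_eq, Finset.mem_filter, Finset.mem_univ, true_and]
    exact and_congr_left fun hi => hP ω (Nat.le_of_succ_le hi)
  have h2 : A ∩ {ω | obs σ M (t + 1) ω = 1} =
      {ω | σ ω ∈ (Finset.univ.filter fun π => P π ∧ relRank π (t + 1) = 1) ∧ t + 1 ≤ M ω} := by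
    ext ω
    simp only [Set.mem_inter_iff, Set.mem_ofPred_eq, Finset.mem_filter, Finset.mem_univ, true_and]
    constructor
    · rintro ⟨hω, ho⟩
      have hM := le_number_of_obs_eq_one ho
      rw [obs, if_pos hM] at ho
      exact ⟨⟨(hP ω (Nat.le_of_succ_le hM)).mp hω, ho⟩, hM⟩
    · rintro ⟨⟨hω, ho⟩, hM⟩
      exact ⟨(hP ω (Nat.le_of_succ_le hM)).mpr hω, by rw [obs, if_pos hM, ho]⟩
  rw [h1, h2, h.measureReal_order_and_number, h.measureReal_order_and_number,
    ← card_filter_relRank_eq_one ht P hP']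
  push_cast
  ring

theorem integrable_duration (h : IsRandomSearch μ p σ M) (t : ℕ) : Integrable (duration σ M t) μ :=
  Integrable.of_bound
    (measurable_duration h.measurable_order h.measurable_number t).aestronglyMeasurable (n + 1)
    (by filter_upwards [h.number_mem] with ω hω using norm_duration_le (Finset.mem_Icc.mp hω).2 t)

/-- Given the observations up to time `t` and `M ≥ t`, the mean time from `t` to the next candidate
or to the end is `t A_t / π_t`. -/
theorem setIntegral_duration (h : IsRandomSearch μ p σ M) {t : ℕ} (ht : 1 ≤ t) (htn : t ≤ n) : ∀ {A : Set Ω},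
    MeasurableSet[info h.measurable_order h.measurable_number t] A → A ⊆ {ω | t ≤ M ω} →
    ∫ ω in A, duration σ M t ω ∂μ = t * ratioSum n p t / tail n p t * μ.real A := by
  have hle : ∀ t, (info h.measurable_order h.measurable_number t : MeasurableSpace Ω) ≤ _ :=
    fun t => (info h.measurable_order h.measurable_number).le t
  induction htn using Nat.decreasingInduction with
  | self =>
    intro A hA hAM
    have h0 := h.tail_pos n (Finset.mem_Icc.mpr ⟨ht, le_rfl⟩)
    have hn : (n : ℝ) ≠ 0 := by positivity
    have h1 : ∫ ω in A, duration σ M n ω ∂μ = ∫ ω in A, (1 : ℝ) ∂μ := by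
      refine setIntegral_congr_ae (hle n A hA) ?_
      filter_upwards [h.number_mem] with ω hω _
      rw [duration, nextTime_eq_of_mem (Or.inr (by have := (Finset.mem_Icc.mp hω).2; omega))]
      push_cast
      ring
    rw [h1, setIntegral_const, smul_eq_mul, ratioSum, Finset.Icc_self, Finset.sum_singleton]
    field_simp
  | of_succ t htn ih =>
    intro A hA hAM
    have h0 := h.tail_pos t (Finset.mem_Icc.mpr ⟨ht, by omega⟩)
    have h0' := h.tail_pos (t + 1) (Finset.mem_Icc.mpr ⟨by omega, htn⟩)
    have ht0 : (t : ℝ) ≠ 0 := by positivity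
    have ht1 : (t : ℝ) + 1 ≠ 0 := by positivity
    set C : Set Ω := {ω | obs σ M (t + 1) ω = 1}
    set L : Set Ω := {ω | t + 1 ≤ M ω}
    have hA' := (info h.measurable_order h.measurable_number).mono (Nat.le_succ t) A hA
    have hC := measurableSet_obs_eq_one h.measurable_order h.measurable_number (t + 1)
    have hL := measurableSet_le_number h.measurable_order h.measurable_number (t := t + 1)
      (by omega) htn
    have hB := (hA'.inter hL).diff hC
    have hCL : C ⊆ L := fun ω hω => le_number_of_obs_eq_one hω
    -- The duration is `1`, plus the duration from time `t + 1` on unless time `t + 1` ends it.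
    have hdur : ∀ ω, duration σ M t ω =
        1 + ((A ∩ L) \ C).indicator (duration σ M (t + 1)) ω ∨ ω ∉ A := by
      intro ω
      by_cases hω : ω ∈ A
      · left
        by_cases hω' : ω ∈ (A ∩ L) \ C
        · have hL' : t + 1 ≤ M ω := hω'.1.2
          have hC' : ¬ obs σ M (t + 1) ω = 1 := hω'.2
          rw [Set.indicator_of_mem hω', duration, duration, nextTime_eq_succ (by omega)]
          push_cast
          ring
        · rw [Set.indicator_of_notMem hω', duration, nextTime_eq_of_mem]
          · push_cast
            ring
          · by_contra hcon
            push Not at hcon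
            exact hω' ⟨⟨hω, hcon.2⟩, hcon.1⟩
      · exact Or.inr hω
    have h1 : ∫ ω in A, duration σ M t ω ∂μ =
        ∫ ω in A, (1 + ((A ∩ L) \ C).indicator (duration σ M (t + 1)) ω) ∂μ :=
      setIntegral_congr_fun (hle t A hA) fun ω hω => (hdur ω).resolve_right (not_not.mpr hω)
    have h2 : μ.real ((A ∩ L) \ C) = μ.real (A ∩ L) - μ.real (A ∩ C) := by
      rw [← measureReal_sdiff (Set.inter_subset_inter_right A hCL) (hle _ _ (hA'.inter hC))]
      congr 1
      ext ω
      simp only [Set.mem_sdiff, Set.mem_inter_iff]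
      tauto
    have h3 := h.tail_mul_measureReal_inter_succ hA
    rw [Set.inter_eq_left.mpr hAM] at h3
    have h4 := h.succ_mul_measureReal_inter_candidate htn hA
    rw [h1, integral_add (integrable_const _).integrableOn
      ((h.integrable_duration _).indicator (hle _ _ hB)).integrableOn, setIntegral_const,
      setIntegral_indicator (hle _ _ hB), Set.inter_eq_right.mpr (fun ω hω => hω.1.1),
      ih (by omega) hB (fun ω hω => hω.1.2), h2, ratioSum_eq_add (show t ≤ n by omega),
      smul_eq_mul, mul_one]
    change tail n p t * μ.real (A ∩ L) = _ at h3
    change ((t : ℝ) + 1) * μ.real (A ∩ C) = μ.real (A ∩ L) at h4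
    have h5 : μ.real (A ∩ C) = μ.real (A ∩ L) / (t + 1) := by
      rw [← h4]; field_simp
    have h6 : μ.real (A ∩ L) = tail n p (t + 1) * μ.real A / tail n p t := by
      rw [← h3]; field_simp
    rw [h5, h6]
    push_cast
    field_simp
    ring

end IsRandomSearch

end Transition

/-! ### Threshold strategies -/

section Threshold

variable {Ω : Type*} {n : ℕ} {σ : Ω → Equiv.Perm (Fin n)} {M : Ω → ℕ} {s : ℕ → ℕ}

theorem hittingAfter_eq_coe {u : ℕ → Ω → ℕ} {N j : ℕ} {ω : Ω}
    (h : hittingAfter u {1} N ω = WithTop.some j) : N ≤ j ∧ u j ω = 1 := by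
  have h1 := le_hittingAfter (u := u) (s := {1}) (n := N) ω
  have h2 := hittingAfter_mem_set_of_ne_top (u := u) (s := {1}) (n := N) (ω := ω) (by simp [h])
  rw [h] at h1 h2
  exact ⟨WithTop.coe_le_coe.mp h1, h2⟩

theorem hittingAfter_of_eq_one {u : ℕ → Ω → ℕ} {N : ℕ} {ω : Ω} (h : u N ω = 1) :
    hittingAfter u {1} N ω = WithTop.some N :=
  le_antisymm (hittingAfter_le_of_mem le_rfl h) (le_hittingAfter ω)

theorem hittingAfter_succ_of_ne_one {u : ℕ → Ω → ℕ} {N : ℕ} {ω : Ω} (h : u N ω ≠ 1) :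
    hittingAfter u {1} (N + 1) ω = hittingAfter u {1} N ω := by
  have hiff : ∀ j, (N + 1 ≤ j ∧ u j ω ∈ ({1} : Set ℕ)) ↔ (N ≤ j ∧ u j ω ∈ ({1} : Set ℕ)) := by
    refine fun j => and_congr_left fun hj => ⟨fun h' => by omega, fun h' => ?_⟩
    refine lt_of_le_of_ne h' ?_
    rintro rfl
    exact h hj
  have hset : {j | N + 1 ≤ j ∧ u j ω ∈ ({1} : Set ℕ)} = {j | N ≤ j ∧ u j ω ∈ ({1} : Set ℕ)} :=
    Set.ext hiff
  unfold hittingAfter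
  congr 1
  · exact propext (exists_congr hiff)
  · exact congrArg (fun S : Set ℕ => WithTop.some (sInf S)) hset

/-- The choice times of the threshold strategy from time `t` on, if a candidate appears at time
`t` and is accepted. -/
theorem thresholdTime_accept {t k : ℕ} {ω : Ω} (h1 : obs σ M t ω = 1) (h2 : s (k + 1) ≤ t) :
    thresholdTime σ M s t (k + 1) 0 ω = WithTop.some t ∧
      ∀ r, thresholdTime σ M s t (k + 1) (r + 1) ω = thresholdTime σ M s (t + 1) k r ω := by
  have h0 : thresholdTime σ M s t (k + 1) 0 ω = WithTop.some t := by
    rw [thresholdTime, max_eq_left h2, hittingAfter_of_eq_one h1]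
  refine ⟨h0, fun r => ?_⟩
  induction r with
  | zero =>
    simp only [thresholdTime] at h0 ⊢
    rw [h0]
    rfl
  | succ r ih => rw [thresholdTime, ih, thresholdTime, Nat.add_sub_add_right]

/-- The choice times of the threshold strategy from time `t` on, if nothing is chosen at time
`t`. -/
theorem thresholdTime_pass {t k : ℕ} {ω : Ω} (h : ¬ (obs σ M t ω = 1 ∧ s k ≤ t)) (r : ℕ) :
    thresholdTime σ M s t k r ω = thresholdTime σ M s (t + 1) k r ω := by
  induction r with
  | zero =>
    rw [thresholdTime, thresholdTime]
    by_cases hs : s k ≤ t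
    · rw [max_eq_left hs, max_eq_left (by omega), hittingAfter_succ_of_ne_one fun h1 => h ⟨h1, hs⟩]
    · rw [max_eq_right (by omega), max_eq_right (by omega)]
  | succ r ih => rw [thresholdTime, thresholdTime, ih]

theorem thresholdTime_candidate {t k j : ℕ} : ∀ {r : ℕ} {ω : Ω},
    thresholdTime σ M s t k r ω = WithTop.some j → obs σ M j ω = 1
  | 0, _, h => (hittingAfter_eq_coe h).2
  | r + 1, ω, h => by
    rw [thresholdTime] at h
    cases hr : thresholdTime σ M s t k r ω with
    | top => simp [hr] at h
    | coe i =>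
      rw [hr] at h
      exact (hittingAfter_eq_coe h).2

theorem thresholdTime_lt_succ {t k r : ℕ} {ω : Ω} :
    thresholdTime σ M s t k r ω < thresholdTime σ M s t k (r + 1) ω ∨
      thresholdTime σ M s t k (r + 1) ω = ⊤ := by
  cases hr : thresholdTime σ M s t k r ω with
  | top => right; rw [thresholdTime, hr]; rfl
  | coe i =>
    cases hr' : thresholdTime σ M s t k (r + 1) ω with
    | top => exact Or.inr rfl
    | coe j =>
      rw [thresholdTime, hr] at hr'
      have := (hittingAfter_eq_coe hr').1
      left
      exact WithTop.coe_lt_coe.mpr (by omega)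

theorem thresholdTime_lt {t k r r' : ℕ} (h : r < r') {ω : Ω} :
    thresholdTime σ M s t k r ω < thresholdTime σ M s t k r' ω ∨
      thresholdTime σ M s t k r' ω = ⊤ := by
  induction r', h using Nat.le_induction with
  | base => exact thresholdTime_lt_succ
  | succ r' hr ih =>
    rcases thresholdTime_lt_succ (σ := σ) (M := M) (s := s) (t := t) (k := k) (r := r') (ω := ω)
      with h1 | h1
    · rcases ih with h2 | h2
      · exact Or.inl (h2.trans h1)
      · simp [h2] at h1
    · exact Or.inr h1

theorem le_thresholdTime {t k r : ℕ} {ω : Ω} :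
    WithTop.some t ≤ thresholdTime σ M s t k r ω := by
  have h0 : WithTop.some t ≤ thresholdTime σ M s t k 0 ω :=
    le_trans (WithTop.coe_le_coe.mpr (le_max_left t (s k))) (le_hittingAfter ω)
  rcases Nat.eq_zero_or_pos r with rfl | hr
  · exact h0
  · rcases thresholdTime_lt (σ := σ) (M := M) (s := s) (t := t) (k := k) hr (ω := ω) with h | h
    · exact h0.trans h.le
    · rw [h]
      exact le_top

theorem isStoppingTime_thresholdTime [MeasurableSpace Ω] (hσ : Measurable σ) (hM : Measurable M)
    (t k r : ℕ) : IsStoppingTime (info hσ hM) (thresholdTime σ M s t k r) := by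
  have hhit : ∀ N, IsStoppingTime (info hσ hM) (hittingAfter (obs σ M) {1} N) := by
    exact fun N => Adapted.isStoppingTime_hittingAfter
      (fun j => measurable_obs_info hσ hM le_rfl) (measurableSet_singleton 1)
  induction r with
  | zero => exact hhit _
  | succ r ih =>
    intro i
    have : {ω | thresholdTime σ M s t k (r + 1) ω ≤ WithTop.some i} = ⋃ j ∈ Set.Iic i,
        {ω | thresholdTime σ M s t k r ω = WithTop.some j} ∩
          {ω | hittingAfter (obs σ M) {1} (max (j + 1) (s (k - (r + 1)))) ω ≤ WithTop.some i} := by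
      ext ω
      simp only [Set.mem_ofPred_eq, Set.mem_iUnion, Set.mem_inter_iff, Set.mem_Iic, exists_prop]
      rw [thresholdTime]
      cases hr : thresholdTime σ M s t k r ω with
      | top => simp
      | coe j =>
        simp only [WithTop.recTopCoe_coe, WithTop.coe_inj]
        constructor
        · intro h
          refine ⟨j, ?_, rfl, h⟩
          have h1 := (le_hittingAfter (u := obs σ M) (s := {1})
            (n := max (j + 1) (s (k - (r + 1)))) ω).trans h
          have h2 : max (j + 1) (s (k - (r + 1))) ≤ i := WithTop.coe_le_coe.mp h1
          omega
        · rintro ⟨j', -, hj, h⟩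
          obtain rfl := hj
          exact h
    rw [this]
    exact MeasurableSet.biUnion (Set.to_countable _) fun j hj =>
      (ih.measurableSet_eq_le hj).inter (hhit _ i)

theorem isStrategy_thresholdStrategy [MeasurableSpace Ω] (hσ : Measurable σ) (hM : Measurable M)
    (t k : ℕ) : IsStrategy hσ hM t k (thresholdStrategy σ M s t k) where
  isStoppingTime r := isStoppingTime_thresholdTime hσ hM t k r
  le _ _ := le_thresholdTime
  increasing _ _ h _ := thresholdTime_lt h
  candidate _ _ _ h := thresholdTime_candidate h

theorem payoff_thresholdStrategy_accept {t k : ℕ} {ω : Ω} (h1 : obs σ M t ω = 1)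
    (h2 : s (k + 1) ≤ t) :
    payoff σ M (thresholdStrategy σ M s t (k + 1)) ω =
      duration σ M t ω + payoff σ M (thresholdStrategy σ M s (t + 1) k) ω := by
  obtain ⟨h3, h4⟩ := thresholdTime_accept (σ := σ) (M := M) h1 h2
  rw [payoff, Fin.sum_univ_succ, payoff]
  simp only [thresholdStrategy, Fin.val_zero, Fin.val_succ, h3, h4]
  rfl

theorem payoff_thresholdStrategy_pass {t k : ℕ} {ω : Ω} (h : ¬ (obs σ M t ω = 1 ∧ s k ≤ t)) :
    payoff σ M (thresholdStrategy σ M s t k) ω =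
      payoff σ M (thresholdStrategy σ M s (t + 1) k) ω := by
  rw [payoff, payoff]
  simp only [thresholdStrategy, thresholdTime_pass h]

end Threshold

/-! ### Dynamic programming -/

section Payoff

variable {Ω : Type*} {n : ℕ} {σ : Ω → Equiv.Perm (Fin n)} {M : Ω → ℕ}

theorem payoff_succ {k : ℕ} (τ : Fin (k + 1) → Ω → WithTop ℕ) (ω : Ω) :
    payoff σ M τ ω = ((τ 0 ω).recTopCoe 0 fun t => duration σ M t ω) +
      payoff σ M (fun r => τ r.succ) ω :=
  Fin.sum_univ_succ _

theorem succ_le_of_coe_lt {t : ℕ} {x : WithTop ℕ} (h : WithTop.some t < x) :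
    WithTop.some (t + 1) ≤ x := by
  cases x with
  | top => exact le_top
  | coe j => exact WithTop.coe_le_coe.mpr (WithTop.coe_lt_coe.mp h)

theorem payoff_zero (τ : Fin 0 → Ω → WithTop ℕ) (ω : Ω) : payoff σ M τ ω = 0 :=
  Fin.sum_univ_zero _

/-- `τ` satisfies on the event `A` the requirements of a strategy from time `t` on. The restriction
to an event makes it possible to continue a strategy after a case distinction at time `t`. -/
structure IsStrategyOn [MeasurableSpace Ω] (hσ : Measurable σ) (hM : Measurable M) (A : Set Ω)
    (t k : ℕ) (τ : Fin k → Ω → WithTop ℕ) : Prop where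
  isStoppingTime : ∀ r, IsStoppingTime (info hσ hM) (τ r)
  le : ∀ r, ∀ ω ∈ A, WithTop.some t ≤ τ r ω
  increasing : ∀ r r', r < r' → ∀ ω ∈ A, τ r ω < τ r' ω ∨ τ r' ω = ⊤
  candidate : ∀ r, ∀ ω ∈ A, ∀ j : ℕ, τ r ω = WithTop.some j → obs σ M j ω = 1

namespace IsStrategyOn

variable [MeasurableSpace Ω] {hσ : Measurable σ} {hM : Measurable M} {A B : Set Ω} {t k : ℕ}

theorem of_isStrategy {τ : Fin k → Ω → WithTop ℕ} (h : IsStrategy hσ hM t k τ) (A : Set Ω) :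
    IsStrategyOn hσ hM A t k τ :=
  ⟨h.isStoppingTime, fun r ω _ => h.le r ω, fun r r' hr ω _ => h.increasing r r' hr ω,
    fun r ω _ j hj => h.candidate r ω j hj⟩

/-- After a choice at time `t`, the other choices form a strategy from time `t + 1` on. -/
theorem tail_of_eq {τ : Fin (k + 1) → Ω → WithTop ℕ} (h : IsStrategyOn hσ hM A t (k + 1) τ)
    (hBA : B ⊆ A) (hB : ∀ ω ∈ B, τ 0 ω = WithTop.some t) :
    IsStrategyOn hσ hM B (t + 1) k fun r => τ r.succ where
  isStoppingTime r := h.isStoppingTime r.succ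
  le r ω hω := by
    rcases h.increasing 0 r.succ r.succ_pos ω (hBA hω) with h1 | h1
    · rw [hB ω hω] at h1
      exact succ_le_of_coe_lt h1
    · rw [h1]
      exact le_top
  increasing r r' hr ω hω := h.increasing _ _ (Fin.succ_lt_succ_iff.mpr hr) ω (hBA hω)
  candidate r ω hω := h.candidate _ ω (hBA hω)

/-- Where no choice is made at time `t`, a strategy from time `t` on is one from time `t + 1` on. -/
theorem succ_of_ne {τ : Fin (k + 1) → Ω → WithTop ℕ} (h : IsStrategyOn hσ hM A t (k + 1) τ)
    (hBA : B ⊆ A) (hB : ∀ ω ∈ B, τ 0 ω ≠ WithTop.some t) :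
    IsStrategyOn hσ hM B (t + 1) (k + 1) τ where
  isStoppingTime := h.isStoppingTime
  le r ω hω := by
    have h0 : WithTop.some t < τ 0 ω := lt_of_le_of_ne (h.le 0 ω (hBA hω)) (hB ω hω).symm
    have hr : WithTop.some t < τ r ω := by
      rcases Fin.eq_zero_or_eq_succ r with rfl | ⟨r, rfl⟩
      · exact h0
      · rcases h.increasing 0 r.succ r.succ_pos ω (hBA hω) with h1 | h1
        · exact h0.trans h1
        · rw [h1]
          exact WithTop.coe_lt_top t
    exact succ_le_of_coe_lt hr
  increasing r r' hr ω hω := h.increasing _ _ hr ω (hBA hω)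
  candidate r ω hω := h.candidate _ ω (hBA hω)

theorem payoff_eq_zero {τ : Fin k → Ω → WithTop ℕ} (h : IsStrategyOn hσ hM A t k τ) (ht : n < t)
    {ω : Ω} (hω : ω ∈ A) : payoff σ M τ ω = 0 := by
  refine Finset.sum_eq_zero fun r _ => ?_
  cases hr : τ r ω with
  | top => rfl
  | coe j =>
    have h1 := h.le r ω hω
    rw [hr] at h1
    have h2 := h.candidate r ω hω j hr
    rw [obs_eq_zero_of_lt (ht.trans_le (WithTop.coe_le_coe.mp h1))] at h2
    exact absurd h2 zero_ne_one

end IsStrategyOn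

theorem measurable_choice [MeasurableSpace Ω] (hσ : Measurable σ) (hM : Measurable M)
    {τ : Ω → WithTop ℕ} (hτ : IsStoppingTime (info hσ hM) τ) :
    Measurable fun ω => WithTop.recTopCoe (C := fun _ => ℝ) 0 (fun t => duration σ M t ω) (τ ω) := by
  intro S hS
  have hfin : ∀ t : ℕ, MeasurableSet {ω | τ ω = WithTop.some t} := fun t =>
    (info hσ hM).le t _ (hτ.measurableSet_eq t)
  have heq : (fun ω => WithTop.recTopCoe (C := fun _ => ℝ) 0 (fun t => duration σ M t ω) (τ ω)) ⁻¹' S =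
      (⋃ t : ℕ, {ω | τ ω = WithTop.some t} ∩ duration σ M t ⁻¹' S) ∪
        ((⋃ t : ℕ, {ω | τ ω = WithTop.some t})ᶜ ∩ {_ω | (0 : ℝ) ∈ S}) := by
    ext ω
    simp only [Set.mem_preimage, Set.mem_union, Set.mem_iUnion, Set.mem_inter_iff,
      Set.mem_compl_iff, Set.mem_ofPred_eq]
    cases τ ω with
    | top => simp
    | coe j =>
      change duration σ M j ω ∈ S ↔ _
      simp
  rw [heq]
  exact (MeasurableSet.iUnion fun t =>
    (hfin t).inter (measurable_duration hσ hM t hS)).union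
      ((MeasurableSet.iUnion hfin).compl.inter (MeasurableSet.const _))

end Payoff

section DynamicProgramming

variable {Ω : Type*} [MeasurableSpace Ω] {μ : Measure Ω} {n : ℕ}
  {p : ℕ → ℝ} {σ : Ω → Equiv.Perm (Fin n)} {M : Ω → ℕ}

/-- The optimal expected payoff, on the event `A` known at time `t`, from the choices made from time
`t` on with `k` choices left. The second summand is the advantage of choosing a candidate at time
`t`. It is `0` for `t > n`, where `π_t = 0`. -/
noncomputable def optimalValue (μ : Measure Ω) (p : ℕ → ℝ) (σ : Ω → Equiv.Perm (Fin n)) (M : Ω → ℕ)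
    (k t : ℕ) (A : Set Ω) : ℝ :=
  (futureValue n p k t * μ.real (A ∩ {ω | t ≤ M ω}) +
    t * max (gain n p k t) 0 * μ.real (A ∩ {ω | obs σ M t ω = 1})) / tail n p t

theorem optimalValue_of_lt {k t : ℕ} (h : n < t) (A : Set Ω) : optimalValue μ p σ M k t A = 0 := by
  rw [optimalValue, tail_of_lt h, div_zero]

theorem optimalValue_nonneg (hp : ∀ j ∈ Finset.Icc 1 n, 0 < tail n p j) {k t : ℕ} (ht : 1 ≤ t)
    (A : Set Ω) : 0 ≤ optimalValue μ p σ M k t A := by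
  rcases lt_or_ge n t with h | h
  · rw [optimalValue_of_lt h]
  · have := hp t (Finset.mem_Icc.mpr ⟨ht, h⟩)
    have : 0 ≤ futureValue n p k t := Finset.sum_nonneg fun _ _ => le_max_right _ _
    unfold optimalValue
    positivity

theorem optimalValue_zero (t : ℕ) (A : Set Ω) : optimalValue μ p σ M 0 t A = 0 := by
  simp [optimalValue, futureValue, gain]

namespace IsRandomSearch

variable [IsProbabilityMeasure μ]

theorem integrable_payoff (h : IsRandomSearch μ p σ M) {k : ℕ} {τ : Fin k → Ω → WithTop ℕ}
    (hτ : ∀ r, IsStoppingTime (info h.measurable_order h.measurable_number) (τ r)) :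
    Integrable (payoff σ M τ) μ := by
  refine integrable_finsetSum _ fun r _ => Integrable.of_bound
    (measurable_choice h.measurable_order h.measurable_number (hτ r)).aestronglyMeasurable
    (n + 1) ?_
  filter_upwards [h.number_mem] with ω hω
  cases τ r ω with
  | top => simp only [WithTop.recTopCoe_top, norm_zero]; positivity
  | coe t => exact norm_duration_le (Finset.mem_Icc.mp hω).2 t

/-- The value from time `t + 1` on, seen from time `t`. -/
theorem optimalValue_succ (h : IsRandomSearch μ p σ M) {k t : ℕ} (ht : 1 ≤ t) (htn : t ≤ n)
    {A : Set Ω} (hA : MeasurableSet[info h.measurable_order h.measurable_number t] A) :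
    optimalValue μ p σ M k (t + 1) A =
      futureValue n p k t * μ.real (A ∩ {ω | t ≤ M ω}) / tail n p t := by
  rcases htn.eq_or_lt with rfl | htn
  · rw [optimalValue_of_lt (Nat.lt_succ_self t)]
    simp [futureValue]
  · have h0 := h.tail_pos t (Finset.mem_Icc.mpr ⟨ht, htn.le⟩)
    have h1 := h.tail_pos (t + 1) (Finset.mem_Icc.mpr ⟨by omega, htn⟩)
    have h2 := h.tail_mul_measureReal_inter_succ hA
    have h3 := h.succ_mul_measureReal_inter_candidate htn hA
    rw [optimalValue, futureValue_eq_add htn, div_eq_div_iff h1.ne' h0.ne']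
    push_cast
    linear_combination (max (gain n p k (t + 1)) 0 * tail n p t) * h3 +
      (max (gain n p k (t + 1)) 0 + futureValue n p k (t + 1)) * h2

/-- The value on `A` if, at time `t` with `k + 1` choices left, exactly the candidates in `B` are
chosen, and the continuation is optimal. -/
theorem duration_add_optimalValue (h : IsRandomSearch μ p σ M) {k t : ℕ} (ht : 1 ≤ t)
    (htn : t ≤ n) {A B : Set Ω}
    (hA : MeasurableSet[info h.measurable_order h.measurable_number t] A)
    (hB : MeasurableSet[info h.measurable_order h.measurable_number t] B)
    (hBA : B ⊆ A ∩ {ω | obs σ M t ω = 1}) :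
    ∫ ω in B, duration σ M t ω ∂μ + optimalValue μ p σ M k (t + 1) B +
        optimalValue μ p σ M (k + 1) (t + 1) (A \ B) =
      (futureValue n p (k + 1) t * μ.real (A ∩ {ω | t ≤ M ω}) +
        (t * ratioSum n p t + futureValue n p k t - futureValue n p (k + 1) t) * μ.real B) /
          tail n p t := by
  have hBL : B ⊆ {ω | t ≤ M ω} := fun ω hω => le_number_of_obs_eq_one (hBA hω).2
  have h1 : μ.real ((A \ B) ∩ {ω | t ≤ M ω}) = μ.real (A ∩ {ω | t ≤ M ω}) - μ.real B := by
    have hsub : B ⊆ A ∩ {ω | t ≤ M ω} := fun ω hω => ⟨(hBA hω).1, hBL hω⟩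
    rw [← measureReal_sdiff hsub ((info h.measurable_order h.measurable_number).le t B hB)]
    congr 1
    ext ω
    simp only [Set.mem_sdiff, Set.mem_inter_iff]
    tauto
  rw [h.setIntegral_duration ht htn hB hBL, h.optimalValue_succ ht htn hB,
    h.optimalValue_succ ht htn (hA.diff hB), h1, Set.inter_eq_left.mpr hBL]
  ring

/-- No strategy from time `t` on has a larger expected payoff than the optimal value. The proof goes
backward in time, by induction on a bound `e` for the number of times left. -/
theorem setIntegral_payoff_le (h : IsRandomSearch μ p σ M)
    (hc : ∀ k, 1 ≤ k → ∀ j ∈ Finset.Icc 1 n, (0 ≤ gain n p k j ↔ critical n p k ≤ j)) (e : ℕ) :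
    ∀ {t k : ℕ} {A : Set Ω} {τ : Fin k → Ω → WithTop ℕ}, 1 ≤ t → n < t + e →
      MeasurableSet[info h.measurable_order h.measurable_number t] A →
      IsStrategyOn h.measurable_order h.measurable_number A t k τ →
      ∫ ω in A, payoff σ M τ ω ∂μ ≤ optimalValue μ p σ M k t A := by
  induction e with
  | zero =>
    intro t k A τ ht hn hA hτ
    rw [setIntegral_eq_zero_of_forall_eq_zero fun ω hω => hτ.payoff_eq_zero (by omega) hω]
    exact optimalValue_nonneg h.tail_pos ht A
  | succ e ih =>
    intro t k A τ ht hn hA hτ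
    rcases lt_or_ge n t with htn | htn
    · rw [setIntegral_eq_zero_of_forall_eq_zero fun ω hω => hτ.payoff_eq_zero htn hω]
      exact optimalValue_nonneg h.tail_pos ht A
    cases k with
    | zero =>
      rw [setIntegral_eq_zero_of_forall_eq_zero fun ω _ => payoff_zero τ ω]
      exact optimalValue_nonneg h.tail_pos ht A
    | succ k =>
      have hmono := (info h.measurable_order h.measurable_number).mono (Nat.le_add_right t 1)
      have hle := (info h.measurable_order h.measurable_number).le t
      set T : Set Ω := {ω | τ 0 ω = WithTop.some t}
      have hT : MeasurableSet[info h.measurable_order h.measurable_number t] T :=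
        (hτ.isStoppingTime 0).measurableSet_eq t
      have hBA : A ∩ T ⊆ A ∩ {ω | obs σ M t ω = 1} := fun ω hω =>
        ⟨hω.1, hτ.candidate 0 ω hω.1 t hω.2⟩
      have hint := h.integrable_payoff hτ.isStoppingTime
      have hint' := h.integrable_payoff (fun r : Fin k => hτ.isStoppingTime r.succ)
      have h1 : ∫ ω in A ∩ T, payoff σ M τ ω ∂μ = ∫ ω in A ∩ T, duration σ M t ω ∂μ +
          ∫ ω in A ∩ T, payoff σ M (fun r => τ r.succ) ω ∂μ := by
        rw [← integral_add (h.integrable_duration t).integrableOn hint'.integrableOn]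
        refine setIntegral_congr_fun (hle _ (hA.inter hT)) fun ω hω => ?_
        have h0 : τ 0 ω = WithTop.some t := hω.2
        simp only [payoff_succ, h0, WithTop.recTopCoe_coe]
      have h2 := ih (by omega) (by omega) (hmono _ (hA.inter hT))
        (hτ.tail_of_eq Set.inter_subset_left fun ω hω => hω.2)
      have h3 := ih (by omega) (by omega) (hmono _ (hA.diff (hA.inter hT)))
        (hτ.succ_of_ne Set.sdiff_subset fun ω hω h0 => hω.2 ⟨hω.1, h0⟩)
      have h4 := integral_inter_add_sdiff (hle _ hT) hint.integrableOn (s := A)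
      rw [Set.sdiff_self_inter] at h3
      have h5 := h.duration_add_optimalValue (k := k) ht htn hA (hA.inter hT) hBA
      rw [Set.sdiff_self_inter] at h5
      have h6 := (max_advantage_eq (k := k) ht htn (fun j hj => (h.tail_pos j hj).ne') hc).1
      -- Of all events of candidates chosen at time `t`, the whole event of a candidate is best if the
      -- advantage is positive, and the empty one otherwise.
      have h7 : optimalValue μ p σ M k (t + 1) (A ∩ T) +
          optimalValue μ p σ M (k + 1) (t + 1) (A \ T) + ∫ ω in A ∩ T, duration σ M t ω ∂μ ≤
          optimalValue μ p σ M (k + 1) t A := by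
        rw [add_right_comm, add_comm (optimalValue μ p σ M k (t + 1) (A ∩ T)), h5, optimalValue,
          ← h6]
        refine div_le_div_of_nonneg_right (add_le_add le_rfl ?_)
          (h.tail_pos t (Finset.mem_Icc.mpr ⟨ht, htn⟩)).le
        exact mul_le_mul (le_max_left _ _) (measureReal_mono hBA) measureReal_nonneg
          (le_max_right _ _)
      linarith

/-- The threshold strategy attains the optimal value. -/
theorem setIntegral_payoff_thresholdStrategy (h : IsRandomSearch μ p σ M)
    (hc : ∀ k, 1 ≤ k → ∀ j ∈ Finset.Icc 1 n, (0 ≤ gain n p k j ↔ critical n p k ≤ j)) (e : ℕ) :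
    ∀ {t k : ℕ} {A : Set Ω}, 1 ≤ t → n < t + e →
      MeasurableSet[info h.measurable_order h.measurable_number t] A →
      ∫ ω in A, payoff σ M (thresholdStrategy σ M (critical n p) t k) ω ∂μ =
        optimalValue μ p σ M k t A := by
  have hlate : ∀ {t k : ℕ} {A : Set Ω}, n < t →
      ∫ ω in A, payoff σ M (thresholdStrategy σ M (critical n p) t k) ω ∂μ =
        optimalValue μ p σ M k t A := by
    intro t k A ht
    rw [setIntegral_eq_zero_of_forall_eq_zero fun ω hω => (IsStrategyOn.of_isStrategy
      (isStrategy_thresholdStrategy h.measurable_order h.measurable_number t k) A).payoff_eq_zero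
        ht hω, optimalValue_of_lt ht]
  induction e with
  | zero => exact fun {t k A} _ hn _ => hlate (by omega)
  | succ e ih =>
    intro t k A ht hn hA
    rcases lt_or_ge n t with htn | htn
    · exact hlate htn
    cases k with
    | zero =>
      rw [setIntegral_eq_zero_of_forall_eq_zero fun ω _ => payoff_zero _ ω, optimalValue_zero]
    | succ k =>
      have hmono := (info h.measurable_order h.measurable_number).mono (Nat.le_add_right t 1)
      have hle := (info h.measurable_order h.measurable_number).le t
      have hC := measurableSet_obs_eq_one h.measurable_order h.measurable_number t
      have hint := fun t k => h.integrable_payoff (isStrategy_thresholdStrategy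
        (s := critical n p) h.measurable_order h.measurable_number t k).isStoppingTime
      obtain ⟨h6, h7⟩ := max_advantage_eq (k := k) ht htn (fun j hj => (h.tail_pos j hj).ne') hc
      by_cases hs : critical n p (k + 1) ≤ t
      · have h1 : ∫ ω in A ∩ {ω | obs σ M t ω = 1},
            payoff σ M (thresholdStrategy σ M (critical n p) t (k + 1)) ω ∂μ =
            ∫ ω in A ∩ {ω | obs σ M t ω = 1}, duration σ M t ω ∂μ +
            ∫ ω in A ∩ {ω | obs σ M t ω = 1},
              payoff σ M (thresholdStrategy σ M (critical n p) (t + 1) k) ω ∂μ := by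
          rw [← integral_add (h.integrable_duration t).integrableOn (hint _ _).integrableOn]
          exact setIntegral_congr_fun (hle _ (hA.inter hC)) fun ω hω =>
            payoff_thresholdStrategy_accept hω.2 hs
        have h2 : ∫ ω in A \ {ω | obs σ M t ω = 1},
            payoff σ M (thresholdStrategy σ M (critical n p) t (k + 1)) ω ∂μ =
            ∫ ω in A \ {ω | obs σ M t ω = 1},
              payoff σ M (thresholdStrategy σ M (critical n p) (t + 1) (k + 1)) ω ∂μ :=
          setIntegral_congr_fun (hle _ (hA.diff hC)) fun ω hω =>
            payoff_thresholdStrategy_pass fun h' => hω.2 h'.1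
        have h5 := h.duration_add_optimalValue (k := k) ht htn hA (hA.inter hC) subset_rfl
        rw [Set.sdiff_self_inter] at h5
        rw [← integral_inter_add_sdiff (hle _ hC) (hint _ _).integrableOn, h1, h2,
          ih (by omega) (by omega) (hmono _ (hA.inter hC)),
          ih (by omega) (by omega) (hmono _ (hA.diff hC)), h5, optimalValue, ← h6,
          max_eq_left (h7.mpr hs)]
      · have h2 : ∫ ω in A, payoff σ M (thresholdStrategy σ M (critical n p) t (k + 1)) ω ∂μ =
            ∫ ω in A, payoff σ M (thresholdStrategy σ M (critical n p) (t + 1) (k + 1)) ω ∂μ :=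
          setIntegral_congr_fun (hle _ hA) fun ω _ =>
            payoff_thresholdStrategy_pass fun h' => hs h'.2
        rw [h2, ih (by omega) (by omega) (hmono _ hA), h.optimalValue_succ ht htn hA, optimalValue,
          ← h6, max_eq_right (not_le.mp fun h' => hs (h7.mp h')).le, zero_mul, add_zero]

/-- The threshold strategy from time `t` on is optimal on every event known at time `t`. -/
theorem setIntegral_payoff_le_thresholdStrategy (h : IsRandomSearch μ p σ M)
    (hc : ∀ k, 1 ≤ k → ∀ j ∈ Finset.Icc 1 n, (0 ≤ gain n p k j ↔ critical n p k ≤ j)) {t k : ℕ}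
    (ht : 1 ≤ t) {A : Set Ω}
    (hA : MeasurableSet[info h.measurable_order h.measurable_number t] A)
    {τ : Fin k → Ω → WithTop ℕ}
    (hτ : IsStrategy h.measurable_order h.measurable_number t k τ) :
    ∫ ω in A, payoff σ M τ ω ∂μ ≤
      ∫ ω in A, payoff σ M (thresholdStrategy σ M (critical n p) t k) ω ∂μ := by
  rw [h.setIntegral_payoff_thresholdStrategy hc n ht (by omega) hA]
  exact h.setIntegral_payoff_le hc n ht (by omega) hA (.of_isStrategy hτ A)

end IsRandomSearch

end DynamicProgramming

theorem condExp_ae_le_of_forall_setIntegral_le {Ω : Type*} {m m0 : MeasurableSpace Ω}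
    {μ : Measure Ω} [IsFiniteMeasure μ] (hm : m ≤ m0) {f g : Ω → ℝ} (hf : Integrable f μ)
    (hg : Integrable g μ)
    (hfg : ∀ A, MeasurableSet[m] A → ∫ ω in A, f ω ∂μ ≤ ∫ ω in A, g ω ∂μ) :
    μ[f | m] ≤ᵐ[μ] μ[g | m] := by
  refine ae_le_of_ae_le_trim (hm := hm) (ae_le_of_forall_setIntegral_le
    (integrable_condExp.trim hm stronglyMeasurable_condExp)
    (integrable_condExp.trim hm stronglyMeasurable_condExp) fun A hA _ => ?_)
  rw [← setIntegral_trim hm stronglyMeasurable_condExp hA,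
    ← setIntegral_trim hm stronglyMeasurable_condExp hA, setIntegral_condExp hm hf hA,
    setIntegral_condExp hm hg hA]
  exact hfg A hA

/-! ### Optimality of the threshold strategy -/

theorem corollary2 {Ω : Type*} [MeasurableSpace Ω] (μ : Measure Ω) [IsProbabilityMeasure μ]
    (n m : ℕ) (hm : 1 ≤ m) (hmn : m < n)
    (σ : Ω → Equiv.Perm (Fin n)) (M : Ω → ℕ) (hσ : Measurable σ) (hM : Measurable M)
    -- all `n!` arrival orders are equally likely
    (hσ_law : ∀ π : Equiv.Perm (Fin n), μ.real (σ ⁻¹' {π}) = 1 / (n ! : ℝ))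
    -- the number of objects is uniform on `{1, …, n}` and independent of the arrival order
    (hM_law : ∀ ℓ : ℕ, μ.real (M ⁻¹' {ℓ}) = uniformPrior n ℓ)
    (hind : IndepFun σ M μ) :
    -- the critical numbers exist, `G^{(k)}` is nonnegative exactly from `s_k` on,
    -- and the critical numbers are nonincreasing in `k`
    (∀ k ∈ Finset.Icc 1 m,
      IsLeast {i | i ∈ Finset.Icc 1 n ∧ 0 ≤ gain n (uniformPrior n) k i}
        (critical n (uniformPrior n) k) ∧
      (∀ i, 1 ≤ i → i < n → 0 ≤ gain n (uniformPrior n) k i →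
        0 ≤ gain n (uniformPrior n) k (i + 1)) ∧
      (∀ i, 1 ≤ i → i < critical n (uniformPrior n) k →
        gain n (uniformPrior n) k i ≤ gain n (uniformPrior n) k (i + 1)) ∧
      (k < m → (∀ i ∈ Finset.Icc 1 n, gain n (uniformPrior n) k i ≤ gain n (uniformPrior n) (k + 1) i) ∧
        critical n (uniformPrior n) (k + 1) ≤ critical n (uniformPrior n) k)) ∧
    -- the threshold strategy maximizes the expected total payoff of the `m`-choice problem
    (IsStrategy hσ hM 1 m (thresholdStrategy σ M (critical n (uniformPrior n)) 1 m) ∧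
      ∀ τ : Fin m → Ω → WithTop ℕ, IsStrategy hσ hM 1 m τ →
        ∫ ω, payoff σ M τ ω ∂μ ≤
          ∫ ω, payoff σ M (thresholdStrategy σ M (critical n (uniformPrior n)) 1 m) ω ∂μ) ∧
    -- it is optimal from every time on, given the observations so far,
    -- whenever `k` choices remain to be made
    (∀ t, 1 ≤ t → ∀ k ∈ Finset.Icc 1 m,
      IsStrategy hσ hM t k (thresholdStrategy σ M (critical n (uniformPrior n)) t k) ∧
      ∀ τ : Fin k → Ω → WithTop ℕ, IsStrategy hσ hM t k τ →
        μ[payoff σ M τ | info hσ hM t] ≤ᵐ[μ]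
          μ[payoff σ M (thresholdStrategy σ M (critical n (uniformPrior n)) t k) | info hσ hM t]) := by
  have hn : 1 ≤ n := by omega
  have hpos : ∀ j ∈ Finset.Icc 1 n, 0 < tail n (uniformPrior n) j := by
    intro j hj
    obtain ⟨h1, h2⟩ := Finset.mem_Icc.mp hj
    have h2' : (j : ℝ) ≤ n := by exact_mod_cast h2
    rw [tail_uniformPrior h1 (by omega)]
    exact div_pos (by linarith) (by exact_mod_cast hn)
  have hcross := gain_crossing hn hpos fun i => decrement_uniformPrior_nonneg
  have hc : ∀ k, 1 ≤ k → ∀ j ∈ Finset.Icc 1 n,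
      (0 ≤ gain n (uniformPrior n) k j ↔ critical n (uniformPrior n) k ≤ j) := by
    intro k hk
    obtain ⟨k, rfl⟩ : ∃ l, k = l + 1 := ⟨k - 1, by omega⟩
    exact (hcross k).1
  have hleast : ∀ k, IsLeast {i | i ∈ Finset.Icc 1 n ∧ 0 ≤ gain n (uniformPrior n) (k + 1) i}
      (critical n (uniformPrior n) (k + 1)) := fun k => isLeast_critical hn (by
    rw [gain_succ_last hn fun j hj => (hpos j hj).ne']
    exact div_nonneg (hpos n (Finset.mem_Icc.mpr ⟨hn, le_rfl⟩)).le (Nat.cast_nonneg n))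
  have hsearch : IsRandomSearch μ (uniformPrior n) σ M :=
    ⟨hσ, hM, hσ_law, hM_law, hind, fun ℓ hℓ => if_neg hℓ, hpos⟩
  have hthr := fun t k => isStrategy_thresholdStrategy (s := critical n (uniformPrior n)) hσ hM t k
  refine ⟨fun k hk => ?_, ⟨hthr 1 m, fun τ hτ => ?_⟩, fun t ht k _ => ⟨hthr t k, fun τ hτ => ?_⟩⟩
  · obtain ⟨k, rfl⟩ : ∃ l, k = l + 1 := ⟨k - 1, by have := (Finset.mem_Icc.mp hk).1; omega⟩
    obtain ⟨hck, hinc, hmono⟩ := hcross k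
    have hs := hleast k
    have hsn := (Finset.mem_Icc.mp hs.1.1).2
    refine ⟨hs, fun i hi hin h => ?_, fun i hi his => ?_, fun _ => ⟨hmono, ?_⟩⟩
    · have := (hck i (Finset.mem_Icc.mpr ⟨hi, hin.le⟩)).mp h
      exact (hck (i + 1) (Finset.mem_Icc.mpr ⟨by omega, hin⟩)).mpr (by omega)
    · exact hinc i hi (by omega) (not_le.mp fun h =>
        absurd ((hck i (Finset.mem_Icc.mpr ⟨hi, by omega⟩)).mp h) (by omega))
    · exact (hleast (k + 1)).2 ⟨hs.1.1, hs.1.2.trans (hmono _ hs.1.1)⟩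
  · simpa using hsearch.setIntegral_payoff_le_thresholdStrategy hc le_rfl MeasurableSet.univ hτ
  · exact condExp_ae_le_of_forall_setIntegral_le ((info hσ hM).le t)
      (hsearch.integrable_payoff hτ.isStoppingTime)
      (hsearch.integrable_payoff (hthr t k).isStoppingTime)
      fun A hA => hsearch.setIntegral_payoff_le_thresholdStrategy hc ht hA hτ
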